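/- Let $G=(V,E)$ be an infinite connected undirected simple graph with bounded degrees. Write $N(x)$ for the set of neighbours of $x$, and put $\Delta=\sup_x|N(x)|<\infty$ and $\delta=\inf_x|N(x)|$. Let $j$ be an integer with $1\le j\le\delta$. For a configuration $\eta\in\{0,1\}^V$ let $c_x(\eta)=\sum_{y\in N(x)}\eta_y$. Let $(L_x(t))_{x\in V,\,t\ge 1}$ be independent random variables, uniform on $[0,1]$, and let $\varepsilon\in[0,1]$. The *$j$-neighbour Bootstrap Percolation with $\varepsilon$-noise* is the process $\omega$ on $\{0,1\}^V$ with $\omega_x(t)=\max\{\omega_x(t-1),\mathbf 1\{c_x(\omega(t-1))\ge j\}\}$ if $L_x(t)\ge\varepsilon$ and $\omega_x(t)=0$ if $L_x(t)<\varepsilon$, for all $x\in V$, $t\ge1$. The *$j$-threshold Consensus Process with $\varepsilon$-noise* is the process $\chi$ with $\chi_x(t)=\mathbf 1\{c_x(\chi(t-1))\ge j\}$ if $L_x(t)\ge\varepsilon$ and $\chi_x(t)=0$ if $L_x(t)<\varepsilon$. For each of the two processes, the *upper invariant measure* $\bar\nu$ (at noise level $\varepsilon$) is the weak limit, as $t\to\infty$,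 of the law at time $t$ of the process started from the all-ones configuration, and the *stability threshold* is $\sup\{\varepsilon\in[0,1] : \bar\nu\ne\delta_{\mathbf 0}\}$, where $\mathbf 0$ is the all-zeros configuration. The stability thresholds of $\omega$ and $\chi$ are denoted by $\varepsilon_c^{\mathrm{BP}}$ and $\varepsilon_c^{\mathrm{CP}}$. Let $\Phi_E=\inf|\partial_E K|/|K|$ and $\Phi_V=\inf|\partial_V K|/|K|$, both infima over the finite nonempty $K\subset V$, where $\partial_E K$ is the set of edges with exactly one endpoint in $K$ and $\partial_V K$ is the set of vertices outside $K$ with a neighbour in $K$. Let $S_k(r)$ be the set of vertices at graph distance $k$ from $r$, and let $\bar\jmath$ be the largest $i\in\mathbb N$ for which there is $r\in V$ such that $|S_{k+1}(r)\cap N(x)|\ge i$ for all $k\ge0$ and all $x\in S_k(r)$. Call $j$ *$\omega$-good* if (a) $j<\Phi_E+1$ or (b) $j\le\bar\jmath$. Call $j$ *$\chi$-good* if (i) $2j<3\Phi_E-\Delta+2$, or (ii) $G$ is bipartite and $j<\Phi_E+1$, or (iii) $j<\Phi_V$, or (iv) $G$ is the $d$-regular tree for some $d\ge2$ and $j<d$.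 **Corollary.** If $j$ is $\omega$-good, then $\varepsilon_c^{\mathrm{BP}}>0$. If $j$ is $\chi$-good, then $\varepsilon_c^{\mathrm{CP}}>0$. -/

import Mathlib

open MeasureTheory Filter Topology
open scoped BoundedContinuousFunction unitInterval

namespace NoisyGraph

noncomputable section

/-! ### Expansion of a locally finite graph -/

/-- `Δ(G)`, the supremum of the degrees (used for graphs of bounded degree only). -/
def supDegree {V : Type*} (G : SimpleGraph V) [G.LocallyFinite] : ℕ := ⨆ x, G.degree x

/-- `δ(G)`, the infimum of the degrees. -/
def infDegree {V : Type*} (G : SimpleGraph V) [G.LocallyFinite] : ℕ := ⨅ x, G.degree x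

/-- The edges of `G` with exactly one endpoint in `K`. -/
def edgeBoundary {V : Type*} (G : SimpleGraph V) (K : Set V) : Set (Sym2 V) :=
  {e | e ∈ G.edgeSet ∧ ∃ x ∈ K, ∃ y ∉ K, e = s(x, y)}

/-- The vertices outside `K` that have a neighbour in `K`. -/
def vertexBoundary {V : Type*} (G : SimpleGraph V) (K : Set V) : Set V :=
  {x | x ∉ K ∧ ∃ y ∈ K, G.Adj x y}

/-- The edge expansion constant `Φ_E(G)`. -/
def edgeExpansion {V : Type*} (G : SimpleGraph V) : ℝ :=
  ⨅ K : {K : Finset V // K.Nonempty},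
    ((edgeBoundary G (K.1 : Set V)).ncard : ℝ) / (K.1.card : ℝ)

/-- The vertex expansion constant `Φ_V(G)`. -/
def vertexExpansion {V : Type*} (G : SimpleGraph V) : ℝ :=
  ⨅ K : {K : Finset V // K.Nonempty},
    ((vertexBoundary G (K.1 : Set V)).ncard : ℝ) / (K.1.card : ℝ)

/-- The sphere `S_k(r)` for the graph distance. -/
def sphere {V : Type*} (G : SimpleGraph V) (r : V) (k : ℕ) : Set V := {y | G.dist r y = k}

/-- The natural numbers `i` such that, for some root `r`, every vertex has at least `i` neighbours
that are farther from `r` than itself. -/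
def outwardSet {V : Type*} (G : SimpleGraph V) : Set ℕ :=
  {i | ∃ r : V, ∀ k : ℕ, ∀ x ∈ sphere G r k, i ≤ (sphere G r (k + 1) ∩ G.neighborSet x).ncard}

/-- `j̄(G)`, the largest element of `outwardSet G` (see `jbar_mem`). -/
def jbar {V : Type*} (G : SimpleGraph V) : ℕ := sSup (outwardSet G)

theorem jbar_mem {V : Type*} [Nonempty V] (G : SimpleGraph V) [G.LocallyFinite]
    (hΔ : BddAbove (Set.range fun x => G.degree x)) :
    IsGreatest (outwardSet G) (jbar G) := by
  have hne : (outwardSet G).Nonempty := ⟨0, Classical.arbitrary V, fun _ _ _ => Nat.zero_le _⟩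
  have hbdd : BddAbove (outwardSet G) := by
    obtain ⟨D, hD⟩ := hΔ
    refine ⟨D, ?_⟩
    rintro i ⟨r, hr⟩
    have h0 := hr 0 r (by simp [sphere])
    have h1 : (sphere G r (0 + 1) ∩ G.neighborSet r).ncard ≤ (G.neighborSet r).ncard :=
      Set.ncard_le_ncard Set.inter_subset_right (Set.toFinite _)
    have h2 : (G.neighborSet r).ncard = G.degree r := by
      rw [Set.ncard_eq_toFinset_card', ← SimpleGraph.card_neighborFinset_eq_degree]
      rfl
    exact (h0.trans h1).trans (h2 ▸ hD ⟨r, rfl⟩)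
  exact ⟨Nat.sSup_mem hne hbdd, fun i hi => le_csSup hbdd hi⟩

/-- `j` is `ω`-good. -/
def OmegaGood {V : Type*} (G : SimpleGraph V) (j : ℕ) : Prop :=
  (j : ℝ) < edgeExpansion G + 1 ∨ j ≤ jbar G

/-- `j` is `χ`-good; the last alternative says that `G` is the `d`-regular tree and `j < d`. -/
def ChiGood {V : Type*} (G : SimpleGraph V) [G.LocallyFinite] (j : ℕ) : Prop :=
  2 * (j : ℝ) < 3 * edgeExpansion G - (supDegree G : ℝ) + 2 ∨
  (G.IsBipartite ∧ (j : ℝ) < edgeExpansion G + 1) ∨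
  (j : ℝ) < vertexExpansion G ∨
  (∃ d : ℕ, 2 ≤ d ∧ G.IsTree ∧ G.IsRegularOfDegree d ∧ j < d)

/-! ### The two processes -/

/-- Configurations in `{0, 1}^V`; `true` is the state 1. -/
abbrev Config (V : Type*) : Type _ := V → Bool

/-- `c_x(η)`, the number of neighbours of `x` in state 1. -/
def countOnes {V : Type*} (G : SimpleGraph V) [G.LocallyFinite] (η : Config V) (x : V) : ℕ :=
  ∑ y ∈ G.neighborFinset x, (η y).toNat

/-- One step of `j`-neighbour Bootstrap Percolation with `ε`-noise, `l x` being the uniform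
variable attached to `x`. The Boolean `||` is the maximum. -/
def bpStep {V : Type*} (G : SimpleGraph V) [G.LocallyFinite] (j : ℕ) (ε : ℝ)
    (l : V → I) (η : Config V) : Config V :=
  fun x => if ε ≤ (l x : ℝ) then η x || decide (j ≤ countOnes G η x) else false

/-- One step of the `j`-threshold Consensus Process with `ε`-noise. -/
def cpStep {V : Type*} (G : SimpleGraph V) [G.LocallyFinite] (j : ℕ) (ε : ℝ)
    (l : V → I) (η : Config V) : Config V :=
  fun x => if ε ≤ (l x : ℝ) then decide (j ≤ countOnes G η x) else false

/-- The trajectory driven by the variables `L (x, t)`, `t ≥ 1`, with initial configuration `ξ`: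
the configuration at time `t + 1` is computed from the one at time `t` and the
variables `L (x, t + 1)`. -/
def run {V : Type*} (step : (V → I) → Config V → Config V) (L : V × ℕ → I) (ξ : Config V) :
    ℕ → Config V
  | 0 => ξ
  | t + 1 => step (fun x => L (x, t + 1)) (run step L ξ t)

theorem measurable_countOnes {V : Type*} (G : SimpleGraph V) [G.LocallyFinite] (x : V) :
    Measurable fun η : Config V => countOnes G η x := by
  unfold countOnes
  refine Finset.measurable_sum _ fun y _ => ?_
  exact (measurable_of_finite Bool.toNat).comp (measurable_pi_apply y)

theorem measurable_run_bpStep {V : Type*} (G : SimpleGraph V) [G.LocallyFinite] (j : ℕ) (ε : ℝ) (t : ℕ) :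
    Measurable fun L : V × ℕ → I => run (bpStep G j ε) L (fun _ => true) t := by
  induction t with
  | zero => exact measurable_const
  | succ t ih =>
    refine measurable_pi_lambda _ fun x => ?_
    simp only [run, bpStep]
    refine Measurable.ite ?_ ?_ measurable_const
    · exact measurableSet_le measurable_const (measurable_subtype_coe.comp (measurable_pi_apply _))
    · have h1 := (measurable_pi_apply x).comp ih
      have h2 := (measurable_countOnes G x).comp ih
      exact (measurable_of_countable (fun p : Bool × ℕ => p.1 || decide (j ≤ p.2))).comp (h1.prodMk h2)

theorem measurable_run_cpStep {V : Type*} (G : SimpleGraph V) [G.LocallyFinite] (j : ℕ) (ε : ℝ) (t : ℕ) :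
    Measurable fun L : V × ℕ → I => run (cpStep G j ε) L (fun _ => true) t := by
  induction t with
  | zero => exact measurable_const
  | succ t ih =>
    refine measurable_pi_lambda _ fun x => ?_
    simp only [run, cpStep]
    refine Measurable.ite ?_ ?_ measurable_const
    · exact measurableSet_le measurable_const (measurable_subtype_coe.comp (measurable_pi_apply _))
    · have h2 := (measurable_countOnes G x).comp ih
      exact (measurable_of_countable (fun p : ℕ => decide (j ≤ p))).comp h2

/-- The joint law of independent random variables `L (x, t)`, uniform on `[0, 1]`. -/
def noiseLaw (V : Type*) : Measure (V × ℕ → I) :=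
  Measure.infinitePi fun _ => (volume : Measure I)

/-- The law at time `t` of the process started from the all-ones configuration. -/
def lawFromOne {V : Type*} (step : (V → I) → Config V → Config V) (t : ℕ) :
    Measure (Config V) :=
  (noiseLaw V).map fun L => run step L (fun _ => true) t

/-- `ν` is the upper invariant measure: the weak limit, as `t → ∞`, of the laws of the
process started from the all-ones configuration. -/
def IsUpperInvariantMeasure {V : Type*} (step : (V → I) → Config V → Config V)
    (ν : Measure (Config V)) : Prop :=
  IsProbabilityMeasure ν ∧
    ∀ f : Config V →ᵇ ℝ,
      Tendsto (fun t : ℕ => ∫ η, f η ∂(lawFromOne step t)) atTop (𝓝 (∫ η, f η ∂ν))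

/-- The supremum of the `ε ∈ [0, 1]` for which the upper invariant measure of the process with
noise level `ε` differs from the point mass at the all-zeros configuration. -/
def stabilityThreshold {V : Type*} (step : ℝ → (V → I) → Config V → Config V) : ℝ :=
  sSup {ε : ℝ | ε ∈ Set.Icc (0 : ℝ) 1 ∧
    ∃ ν : Measure (Config V), IsUpperInvariantMeasure (step ε) ν ∧
      ν ≠ Measure.dirac (fun _ => false)}

/-- The stability threshold of `j`-neighbour Bootstrap Percolation with noise. -/
def bpThreshold {V : Type*} (G : SimpleGraph V) [G.LocallyFinite] (j : ℕ) : ℝ :=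
  stabilityThreshold (bpStep G j)

/-- The stability threshold of the `j`-threshold Consensus Process with noise. -/
def cpThreshold {V : Type*} (G : SimpleGraph V) [G.LocallyFinite] (j : ℕ) : ℝ :=
  stabilityThreshold (cpStep G j)

end

end NoisyGraph

namespace NoisyGraph

/-! ### The upper invariant measure -/

/-- The noise field with the time coordinate shifted by one. -/
def shiftNoise {V : Type*} (L : V × ℕ → I) : V × ℕ → I := fun p => L (p.1, p.2 + 1)

/-- The configuration obtained from all ones by applying the steps with noise at times
`t, t - 1, …, 1`, in this order. -/
def backRun {V : Type*} (step : (V → I) → Config V → Config V) :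
    ℕ → (V × ℕ → I) → Config V
  | 0, _ => fun _ => true
  | t + 1, L => step (fun x => L (x, 1)) (backRun step t (shiftNoise L))

theorem run_eq_backRun {V : Type*} (step : (V → I) → Config V → Config V) (t : ℕ) :
    ∀ L L' : V × ℕ → I, (∀ x s, 1 ≤ s → s ≤ t → L' (x, s) = L (x, t + 1 - s)) →
      run step L' (fun _ => true) t = backRun step t L := by
  induction t with
  | zero => intro L L' _; rfl
  | succ t ih =>
    intro L L' h
    have h1 : (fun x => L' (x, t + 1)) = fun x => L (x, 1) := by
      funext x
      rw [h x (t + 1) (by omega) le_rfl]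
      congr 2
      omega
    simp only [run, backRun, h1]
    congr 1
    apply ih
    intro x s hs1 hs2
    rw [h x s hs1 (by omega), shiftNoise]
    congr 2
    show t + 1 + 1 - s = t + 1 - s + 1
    omega

theorem backRun_antitone {V : Type*} (step : (V → I) → Config V → Config V)
    (hmono : ∀ l, Monotone (step l)) (L : V × ℕ → I) :
    Antitone fun t => backRun step t L := by
  apply antitone_nat_of_succ_le
  intro t
  induction t generalizing L with
  | zero => intro x; exact Bool.le_true _
  | succ t ih => exact hmono _ (ih (shiftNoise L))

/-- Reversal of the times `1, …, t`. -/
def timeReversal (V : Type*) (t : ℕ) : V × ℕ ≃ V × ℕ :=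
  Equiv.prodCongr (Equiv.refl V) (Function.Involutive.toPerm
    (fun s => if 1 ≤ s ∧ s ≤ t then t + 1 - s else s) (by
      intro s
      simp only
      split_ifs <;> omega))

instance isProbabilityMeasure_noiseLaw (V : Type*) : IsProbabilityMeasure (noiseLaw V) := by
  unfold noiseLaw; infer_instance

theorem noiseLaw_map_equiv {V : Type*} (e : V × ℕ ≃ V × ℕ) :
    (noiseLaw V).map (fun L p => L (e p)) = noiseLaw V := by
  refine Measure.eq_infinitePi _ fun s t ht => ?_
  rw [Measure.map_apply (by fun_prop) (MeasurableSet.pi s.countable_toSet fun i _ => ht i)]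
  have : (fun (L : V × ℕ → I) p => L (e p)) ⁻¹' (Set.pi s t)
      = Set.pi (s.map e.toEmbedding) fun p => t (e.symm p) := by
    ext L
    simp only [Set.mem_preimage, Set.mem_pi, Finset.mem_coe, Finset.mem_map_equiv]
    exact ⟨fun h p hp => by simpa using h _ hp, fun h p hp => by simpa using h (e p) (by simpa)⟩
  rw [this, noiseLaw, Measure.infinitePi_pi _ (fun i _ => ht _)]
  simp

theorem lawFromOne_eq_backRun {V : Type*} (step : (V → I) → Config V → Config V)
    (hmeas : ∀ t, Measurable fun L : V × ℕ → I => run step L (fun _ => true) t) (t : ℕ) :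
    lawFromOne step t = (noiseLaw V).map (backRun step t) := by
  have key : ∀ L : V × ℕ → I,
      run step (fun p => L (timeReversal V t p)) (fun _ => true) t = backRun step t L := by
    intro L
    apply run_eq_backRun
    intro x s h1 h2
    simp [timeReversal, h1, h2, Function.Involutive.toPerm]
  rw [lawFromOne]
  conv_lhs => rw [← noiseLaw_map_equiv (timeReversal V t)]
  rw [Measure.map_map (hmeas t) (by fun_prop)]
  congr 1
  funext L
  exact key L

theorem measurable_backRun {V : Type*} (step : (V → I) → Config V → Config V)
    (hmeas : ∀ t, Measurable fun L : V × ℕ → I => run step L (fun _ => true) t) (t : ℕ) :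
    Measurable (backRun step t) := by
  have : backRun step t = (fun L => run step L (fun _ => true) t) ∘
      fun (L : V × ℕ → I) p => L (timeReversal V t p) := by
    funext L
    symm
    apply run_eq_backRun
    intro x s h1 h2
    simp [timeReversal, h1, h2, Function.Involutive.toPerm]
  rw [this]
  exact (hmeas t).comp (by fun_prop)

/-- The limit of `backRun`. -/
noncomputable def backLimit {V : Type*} (step : (V → I) → Config V → Config V) (L : V × ℕ → I) :
    Config V := by
  classical exact fun x => decide (∀ t, backRun step t L x = true)

theorem tendsto_backRun {V : Type*} (step : (V → I) → Config V → Config V)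
    (hmono : ∀ l, Monotone (step l)) (L : V × ℕ → I) :
    Tendsto (fun t => backRun step t L) atTop (𝓝 (backLimit step L)) := by
  rw [tendsto_pi_nhds]
  intro x
  apply tendsto_nhds_of_eventually_eq
  by_cases h : ∀ t, backRun step t L x = true
  · exact Eventually.of_forall fun t => by simp [backLimit, h]
  · have h' : backLimit step L x = false := by simp [backLimit, h]
    push Not at h
    obtain ⟨t₀, ht₀⟩ := h
    filter_upwards [eventually_ge_atTop t₀] with t ht
    have : backRun step t L x ≤ backRun step t₀ L x := backRun_antitone step hmono L ht x
    rw [h']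
    simp only [ne_eq, Bool.not_eq_true] at ht₀
    rw [ht₀] at this
    exact Bool.eq_false_of_le_false this

theorem stabilityThreshold_pos {V : Type*} [Countable V]
    (step : ℝ → (V → I) → Config V → Config V)
    (hmono : ∀ ε l, Monotone (step ε l))
    (hmeas : ∀ ε t, Measurable fun L : V × ℕ → I => run (step ε) L (fun _ => true) t)
    (ε : ℝ) (hε0 : 0 < ε) (hε1 : ε ≤ 1) (x : V)
    (hx : ∀ t, (noiseLaw V).real {L | run (step ε) L (fun _ => true) t x = false} ≤ 1 / 2) :
    0 < stabilityThreshold step := by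
  refine lt_of_lt_of_le hε0 (le_csSup ⟨1, fun e he => he.1.2⟩ ⟨⟨hε0.le, hε1⟩, ?_⟩)
  have hback := measurable_backRun (step ε) (hmeas ε)
  have hlim : Measurable (backLimit (step ε)) :=
    measurable_of_tendsto_metrizable hback
      (tendsto_pi_nhds.2 fun L => tendsto_backRun _ (hmono ε) L)
  refine ⟨(noiseLaw V).map (backLimit (step ε)),
    ⟨Measure.isProbabilityMeasure_map hlim.aemeasurable, fun f => ?_⟩, ?_⟩
  · simp_rw [lawFromOne_eq_backRun _ (hmeas ε)]
    rw [integral_map hlim.aemeasurable f.continuous.aestronglyMeasurable]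
    simp_rw [integral_map (hback _).aemeasurable
      (f.continuous.aestronglyMeasurable : AEStronglyMeasurable f _)]
    refine tendsto_integral_of_dominated_convergence (fun _ => ‖f‖)
      (fun t => (f.continuous.measurable.comp (hback t)).aestronglyMeasurable)
      (integrable_const _) (fun t => Eventually.of_forall fun L => f.norm_coe_le_norm _)
      (Eventually.of_forall fun L => ?_)
    exact (f.continuous.tendsto _).comp (tendsto_backRun _ (hmono ε) L)
  · intro heq
    have heval : Measurable fun η : Config V => η x := measurable_pi_apply x
    have hset : MeasurableSet {η : Config V | η x = true} := heval (measurableSet_singleton true)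
    have h0 : (noiseLaw V).map (backLimit (step ε)) {η : Config V | η x = true} = 0 := by
      rw [heq, Measure.dirac_apply' _ hset]
      simp
    rw [Measure.map_apply hlim hset] at h0
    have hinter : backLimit (step ε) ⁻¹' {η : Config V | η x = true}
        = ⋂ t, {L | backRun (step ε) t L x = true} := by
      ext L
      simp [backLimit]
    rw [hinter] at h0
    have hmt : ∀ t, MeasurableSet {L | backRun (step ε) t L x = true} := fun t =>
      hback t hset
    have htend := tendsto_measure_iInter_atTop (μ := noiseLaw V)
      (s := fun t => {L | backRun (step ε) t L x = true})
      (fun t => (hmt t).nullMeasurableSet)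
      (fun s t hst L hL => by
        have : backRun (step ε) t L x ≤ backRun (step ε) s L x :=
          backRun_antitone (step ε) (hmono ε) L hst x
        simp only [Set.mem_ofPred_eq] at hL ⊢
        rw [hL] at this
        exact Bool.eq_true_of_true_le this) ⟨0, measure_ne_top _ _⟩
    rw [h0] at htend
    have hhalf : ∀ t, (1 / 2 : ENNReal) ≤ noiseLaw V {L | backRun (step ε) t L x = true} := by
      intro t
      have hcompl : {L : V × ℕ → I | run (step ε) L (fun _ => true) t x = true}
          = {L | run (step ε) L (fun _ => true) t x = false}ᶜ := by
        ext L; simp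
      have hm : MeasurableSet {L : V × ℕ → I | run (step ε) L (fun _ => true) t x = false} :=
        heval.comp (hmeas ε t) (measurableSet_singleton false)
      have hr : (1 / 2 : ℝ) ≤ (noiseLaw V).real
          {L : V × ℕ → I | run (step ε) L (fun _ => true) t x = true} := by
        rw [hcompl, probReal_compl_eq_one_sub hm]
        linarith [hx t]
      have e1 : noiseLaw V {L | backRun (step ε) t L x = true}
          = noiseLaw V {L : V × ℕ → I | run (step ε) L (fun _ => true) t x = true} := by
        have a1 := Measure.map_apply (μ := noiseLaw V) (hback t) hset
        have a2 := Measure.map_apply (μ := noiseLaw V) (hmeas ε t) hset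
        have a3 := lawFromOne_eq_backRun (step ε) (hmeas ε) t
        rw [← a3, lawFromOne, a2] at a1
        exact a1.symm
      rw [e1, ← ENNReal.ofReal_toReal (measure_ne_top (noiseLaw V) _)]
      rw [show (1 / 2 : ENNReal) = ENNReal.ofReal (1 / 2) by
        rw [ENNReal.ofReal_div_of_pos (by norm_num)]; simp]
      exact ENNReal.ofReal_le_ofReal hr
    have := ge_of_tendsto' htend hhalf
    simp at this

/-! ### Noise and the set of zeros -/

/-- The event that all the space-time points of `N` are noisy. -/
def noisy {V : Type*} (ε : ℝ) (N : Finset (V × ℕ)) : Set (V × ℕ → I) :=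
  {L | ∀ p ∈ N, (L p : ℝ) < ε}

theorem noiseLaw_noisy {V : Type*} {ε : ℝ} (h0 : 0 ≤ ε) (h1 : ε ≤ 1) (N : Finset (V × ℕ)) :
    noiseLaw V (noisy ε N) = ENNReal.ofReal ε ^ N.card := by
  have : noisy ε N = Set.pi N fun _ => Set.Iio (⟨ε, h0, h1⟩ : I) := by
    ext L
    simp only [noisy, Set.mem_pi, Finset.mem_coe]
    exact Iff.rfl
  rw [this, noiseLaw, Measure.infinitePi_pi _ (fun i _ => measurableSet_Iio)]
  simp [unitInterval.volume_Iio]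

theorem noiseLaw_real_noisy {V : Type*} {ε : ℝ} (h0 : 0 ≤ ε) (h1 : ε ≤ 1) (N : Finset (V × ℕ)) :
    (noiseLaw V).real (noisy ε N) = ε ^ N.card := by
  rw [measureReal_def, noiseLaw_noisy h0 h1, ENNReal.toReal_pow, ENNReal.toReal_ofReal h0]

/-- The set of vertices in state 0 at time `t`, for the process started from all ones. -/
def zeros {V : Type*} (step : (V → I) → Config V → Config V) (L : V × ℕ → I) (t : ℕ) : Set V :=
  {x | run step L (fun _ => true) t x = false}

theorem not_mem_zeros_zero {V : Type*} (step : (V → I) → Config V → Config V) (L : V × ℕ → I)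
    (x : V) : x ∉ zeros step L 0 := by
  simp [zeros, run]

/-- The number of neighbours of `x` outside `U`. -/
noncomputable def outDeg {V : Type*} (G : SimpleGraph V) [G.LocallyFinite] (U : Set V) (x : V) :
    ℕ := by
  classical exact ((G.neighborFinset x).filter (· ∉ U)).card

theorem outDeg_eq_card {V : Type*} (G : SimpleGraph V) [G.LocallyFinite] (U : Set V)
    [DecidablePred (· ∉ U)] (x : V) :
    outDeg G U x = ((G.neighborFinset x).filter (· ∉ U)).card := by
  unfold outDeg
  congr

theorem outDeg_mono {V : Type*} (G : SimpleGraph V) [G.LocallyFinite] {U W : Set V} {x : V}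
    (h : ∀ y, G.Adj x y → y ∈ U → y ∈ W) : outDeg G W x ≤ outDeg G U x := by
  classical
  unfold outDeg
  refine Finset.card_le_card fun y hy => ?_
  simp only [Finset.mem_filter, SimpleGraph.mem_neighborFinset] at hy ⊢
  exact ⟨hy.1, fun hU => hy.2 (h y hy.1 hU)⟩

theorem countOnes_eq_outDeg {V : Type*} (G : SimpleGraph V) [G.LocallyFinite]
    (η : Config V) (x : V) : countOnes G η x = outDeg G {y | η y = false} x := by
  classical
  unfold countOnes outDeg
  rw [Finset.card_filter]
  refine Finset.sum_congr rfl fun y _ => ?_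
  cases h : η y <;> simp [h]

theorem countOnes_mono {V : Type*} (G : SimpleGraph V) [G.LocallyFinite] {η ξ : Config V}
    (h : η ≤ ξ) (x : V) : countOnes G η x ≤ countOnes G ξ x :=
  Finset.sum_le_sum fun y _ => Bool.toNat_le_toNat (h y)

theorem bpStep_mono {V : Type*} (G : SimpleGraph V) [G.LocallyFinite] (j : ℕ) (ε : ℝ) (l : V → I) :
    Monotone (bpStep G j ε l) := by
  intro η ξ h x
  simp only [bpStep]
  split_ifs with hx
  · have h1 : η x = true → ξ x = true := fun h' => by
      have := h x; rw [h'] at this; exact Bool.eq_true_of_true_le this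
    refine Bool.le_iff_imp.2 fun h2 => ?_
    simp only [Bool.or_eq_true, decide_eq_true_eq] at h2 ⊢
    exact h2.imp h1 fun h3 => h3.trans (countOnes_mono G h x)
  · exact le_rfl

theorem cpStep_mono {V : Type*} (G : SimpleGraph V) [G.LocallyFinite] (j : ℕ) (ε : ℝ) (l : V → I) :
    Monotone (cpStep G j ε l) := by
  intro η ξ h x
  simp only [cpStep]
  split_ifs with hx
  · refine Bool.le_iff_imp.2 fun h2 => ?_
    simp only [decide_eq_true_eq] at h2 ⊢
    exact h2.trans (countOnes_mono G h x)
  · exact le_rfl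

theorem mem_zeros_bpStep_succ {V : Type*} (G : SimpleGraph V) [G.LocallyFinite] (j : ℕ) (ε : ℝ)
    (L : V × ℕ → I) (t : ℕ) (x : V) (hx : x ∈ zeros (bpStep G j ε) L (t + 1)) :
    (L (x, t + 1) : ℝ) < ε ∨
      (x ∈ zeros (bpStep G j ε) L t ∧ outDeg G (zeros (bpStep G j ε) L t) x < j) := by
  by_cases h : (L (x, t + 1) : ℝ) < ε
  · exact Or.inl h
  · right
    simp only [zeros, run, bpStep, Set.mem_ofPred_eq, not_lt.1 h, if_true, Bool.or_eq_false_iff,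
      decide_eq_false_iff_not, not_le, countOnes_eq_outDeg] at hx ⊢
    exact hx

theorem mem_zeros_cpStep_succ {V : Type*} (G : SimpleGraph V) [G.LocallyFinite] (j : ℕ) (ε : ℝ)
    (L : V × ℕ → I) (t : ℕ) (x : V) (hx : x ∈ zeros (cpStep G j ε) L (t + 1)) :
    (L (x, t + 1) : ℝ) < ε ∨ outDeg G (zeros (cpStep G j ε) L t) x < j := by
  by_cases h : (L (x, t + 1) : ℝ) < ε
  · exact Or.inl h
  · right
    simp only [zeros, run, cpStep, Set.mem_ofPred_eq, not_lt.1 h, if_true,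
      decide_eq_false_iff_not, not_le, countOnes_eq_outDeg] at hx ⊢
    exact hx

/-- The endpoints of the walks of length `n` from `x`. -/
noncomputable def walkEnds {V : Type*} (G : SimpleGraph V) [G.LocallyFinite] : ℕ → V → Finset V
  | 0, x => {x}
  | n + 1, x => by classical exact (G.neighborFinset x).biUnion (walkEnds G n)

theorem card_walkEnds_le {V : Type*} (G : SimpleGraph V) [G.LocallyFinite] {D : ℕ}
    (hD : ∀ x, G.degree x ≤ D) (n : ℕ) (x : V) : (walkEnds G n x).card ≤ D ^ n := by
  classical
  induction n generalizing x with
  | zero => simp [walkEnds]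
  | succ n ih =>
    simp only [walkEnds]
    refine (Finset.card_biUnion_le_card_mul _ _ _ fun y _ => ih y).trans ?_
    rw [SimpleGraph.card_neighborFinset_eq_degree, pow_succ']
    exact Nat.mul_le_mul_right _ (hD x)

theorem mem_walkEnds {V : Type*} {G : SimpleGraph V} [G.LocallyFinite] {x y : V}
    (p : G.Walk x y) : y ∈ walkEnds G p.length x := by
  classical
  induction p with
  | nil => simp [walkEnds]
  | cons h p ih =>
    simp only [SimpleGraph.Walk.length_cons, walkEnds, Finset.mem_biUnion,
      SimpleGraph.mem_neighborFinset]
    exact ⟨_, h, ih⟩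

theorem countable_of_connected {V : Type*} (G : SimpleGraph V) [G.LocallyFinite]
    (hconn : G.Connected) : Countable V := by
  obtain ⟨r⟩ := hconn.nonempty
  rw [← Set.countable_univ_iff]
  refine (Set.countable_iUnion fun n => (walkEnds G n r).countable_toSet).mono fun y _ => ?_
  obtain ⟨p⟩ := hconn r y
  exact Set.mem_iUnion.2 ⟨p.length, mem_walkEnds p⟩

theorem bpThreshold_pos {V : Type*} (G : SimpleGraph V) [G.LocallyFinite] (hconn : G.Connected)
    (j : ℕ) (ε : ℝ) (hε0 : 0 < ε) (hε1 : ε ≤ 1) (x : V)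
    (hx : ∀ t, (noiseLaw V).real {L | x ∈ zeros (bpStep G j ε) L t} ≤ 1 / 2) :
    0 < bpThreshold G j :=
  have := countable_of_connected G hconn
  stabilityThreshold_pos _ (bpStep_mono G j) (measurable_run_bpStep G j) ε hε0 hε1 x hx

theorem cpThreshold_pos {V : Type*} (G : SimpleGraph V) [G.LocallyFinite] (hconn : G.Connected)
    (j : ℕ) (ε : ℝ) (hε0 : 0 < ε) (hε1 : ε ≤ 1) (x : V)
    (hx : ∀ t, (noiseLaw V).real {L | x ∈ zeros (cpStep G j ε) L t} ≤ 1 / 2) :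
    0 < cpThreshold G j :=
  have := countable_of_connected G hconn
  stabilityThreshold_pos _ (cpStep_mono G j) (measurable_run_cpStep G j) ε hε0 hε1 x hx

/-! ### Processes whose explanations expand -/

theorem noiseLaw_zeros_le {V : Type*} (G : SimpleGraph V) [G.LocallyFinite] {D : ℕ}
    (hD : ∀ x, G.degree x ≤ D) (Expl : Set V → V → Prop)
    (hloc : ∀ (U W : Set V) (x : V), (∀ y, (y = x ∨ G.Adj x y) → y ∈ U → y ∈ W) →
      Expl U x → Expl W x)
    (h : V → ℝ) (c s ε : ℝ) (hε0 : 0 ≤ ε) (hε1 : ε ≤ 1)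
    (hpot : ∀ B U : Finset V, (∀ x ∈ B, Expl (U : Set V) x) → ∑ x ∈ B, (h x + c) ≤ ∑ x ∈ U, h x)
    (hs0 : 0 ≤ s) (hs : 2 ^ (D + 1) * Real.exp (-(s * c)) ≤ 1 / 2)
    (hε : ∀ x, ε ≤ Real.exp (-(s * h x)) / 2)
    (Z : (V × ℕ → I) → ℕ → Set V) (hZ0 : ∀ L x, x ∉ Z L 0)
    (hZ : ∀ L t x, x ∈ Z L (t + 1) → (L (x, t + 1) : ℝ) < ε ∨ Expl (Z L t) x) (t : ℕ) :
    ∀ (N : Finset (V × ℕ)) (A : Finset V), (∀ p ∈ N, t < p.2) →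
      (noiseLaw V).real {L | L ∈ noisy ε N ∧ ∀ x ∈ A, x ∈ Z L t} ≤
        ε ^ N.card * ∏ x ∈ A, Real.exp (-(s * h x)) := by
  classical
  induction t with
  | zero =>
    intro N A hN
    rcases A.eq_empty_or_nonempty with rfl | ⟨a, ha⟩
    · simpa using (noiseLaw_real_noisy hε0 hε1 N).le
    · have : {L : V × ℕ → I | L ∈ noisy ε N ∧ ∀ x ∈ A, x ∈ Z L 0} = ∅ := by
        ext L
        simp only [Set.mem_ofPred_eq, Set.mem_empty_iff_false, iff_false, not_and]
        exact fun _ h => hZ0 L a (h a ha)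
      rw [this, measureReal_empty]
      positivity
  | succ t ih =>
    intro N A hN
    let nb : Finset V → Finset V := fun B => B.biUnion fun x => insert x (G.neighborFinset x)
    let late : Finset V → Finset (V × ℕ) := fun B => (A \ B).map ⟨fun x => (x, t + 1), fun x y h => by simpa using h⟩
    have hsub : {L : V × ℕ → I | L ∈ noisy ε N ∧ ∀ x ∈ A, x ∈ Z L (t + 1)} ⊆
        ⋃ B ∈ A.powerset, ⋃ U ∈ (nb B).powerset.filter (fun U : Finset V => ∀ x ∈ B, Expl (U : Set V) x),
          {L | L ∈ noisy ε (N ∪ late B) ∧ ∀ x ∈ U, x ∈ Z L t} := by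
      rintro L ⟨hN', hA⟩
      let B := A.filter fun x => ¬ (L (x, t + 1) : ℝ) < ε
      let U := (nb B).filter (· ∈ Z L t)
      simp only [Set.mem_iUnion]
      refine ⟨B, Finset.mem_powerset.2 (Finset.filter_subset _ _), U, ?_, ?_, ?_⟩
      · refine Finset.mem_filter.2 ⟨Finset.mem_powerset.2 (Finset.filter_subset _ _), ?_⟩
        intro x hx
        have hx' := Finset.mem_filter.1 hx
        refine hloc _ _ x ?_ ((hZ L t x (hA x hx'.1)).resolve_left hx'.2)
        intro y hy hyZ
        simp only [U, nb, Finset.coe_filter, Finset.mem_biUnion, Set.mem_ofPred_eq,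
          Finset.mem_insert, SimpleGraph.mem_neighborFinset]
        exact ⟨⟨x, hx, hy⟩, hyZ⟩
      · intro p hp
        rcases Finset.mem_union.1 hp with hp | hp
        · exact hN' p hp
        · simp only [late, Finset.mem_map, Finset.mem_sdiff] at hp
          obtain ⟨x, ⟨hxA, hxB⟩, rfl⟩ := hp
          by_contra hcon
          exact hxB (Finset.mem_filter.2 ⟨hxA, hcon⟩)
      · intro x hx
        exact (Finset.mem_filter.1 hx).2
    have hcard : ∀ B, (N ∪ late B).card = N.card + (A \ B).card := by
      intro B
      rw [Finset.card_union_of_disjoint, Finset.card_map]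
      rw [Finset.disjoint_left]
      intro p hp hp'
      simp only [late, Finset.mem_map] at hp'
      obtain ⟨x, _, rfl⟩ := hp'
      exact lt_irrefl _ (hN _ hp)
    have hlate : ∀ B, ∀ p ∈ N ∪ late B, t < p.2 := by
      intro B p hp
      rcases Finset.mem_union.1 hp with hp | hp
      · exact (Nat.lt_succ_self t).trans (hN p hp)
      · simp only [late, Finset.mem_map] at hp
        obtain ⟨x, _, rfl⟩ := hp
        exact Nat.lt_succ_self t
    have hnb : ∀ B, (nb B).card ≤ (D + 1) * B.card := by
      intro B
      rw [mul_comm]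
      refine Finset.card_biUnion_le_card_mul _ _ _ fun x _ => ?_
      refine (Finset.card_insert_le _ _).trans ?_
      rw [SimpleGraph.card_neighborFinset_eq_degree]
      exact Nat.succ_le_succ (hD x)
    calc (noiseLaw V).real {L | L ∈ noisy ε N ∧ ∀ x ∈ A, x ∈ Z L (t + 1)}
        ≤ (noiseLaw V).real (⋃ B ∈ A.powerset,
            ⋃ U ∈ (nb B).powerset.filter (fun U : Finset V => ∀ x ∈ B, Expl (U : Set V) x),
          {L | L ∈ noisy ε (N ∪ late B) ∧ ∀ x ∈ U, x ∈ Z L t}) := measureReal_mono hsub (measure_ne_top _ _)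
      _ ≤ ∑ B ∈ A.powerset, ∑ U ∈ (nb B).powerset.filter (fun U : Finset V => ∀ x ∈ B, Expl (U : Set V) x),
            (noiseLaw V).real {L | L ∈ noisy ε (N ∪ late B) ∧ ∀ x ∈ U, x ∈ Z L t} :=
          (measureReal_biUnion_finset_le _ _).trans
            (Finset.sum_le_sum fun B _ => measureReal_biUnion_finset_le _ _)
      _ ≤ ∑ B ∈ A.powerset, ε ^ N.card * ((∏ x ∈ B, Real.exp (-(s * h x)) / 2) *
            ∏ _x ∈ A \ B, ε) := by
          refine Finset.sum_le_sum fun B _ => ?_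
          have hterm : ∀ U ∈ (nb B).powerset.filter (fun U : Finset V => ∀ x ∈ B, Expl (U : Set V) x),
              (noiseLaw V).real {L | L ∈ noisy ε (N ∪ late B) ∧ ∀ x ∈ U, x ∈ Z L t} ≤
              ε ^ N.card * (∏ _x ∈ A \ B, ε) *
                ∏ x ∈ B, (Real.exp (-(s * h x)) * Real.exp (-(s * c))) := by
            intro U hU
            refine (ih (N ∪ late B) U (hlate B)).trans ?_
            rw [hcard, pow_add, Finset.prod_const ε]
            refine mul_le_mul_of_nonneg_left ?_ (by positivity)
            simp_rw [← Real.exp_add]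
            rw [← Real.exp_sum, ← Real.exp_sum, Real.exp_le_exp]
            have := mul_le_mul_of_nonneg_left (hpot B U (Finset.mem_filter.1 hU).2) hs0
            rw [Finset.mul_sum, Finset.mul_sum] at this
            have e1 : ∑ x ∈ B, (-(s * h x) + -(s * c)) = -∑ x ∈ B, s * (h x + c) := by
              rw [← Finset.sum_neg_distrib]
              exact Finset.sum_congr rfl fun x _ => by ring
            rw [e1, Finset.sum_neg_distrib]
            linarith
          refine (Finset.sum_le_card_nsmul _ _ _ hterm).trans ?_
          have hc1 : (((nb B).powerset.filter (fun U : Finset V => ∀ x ∈ B, Expl (U : Set V) x)).card : ℝ) ≤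
              ∏ _x ∈ B, (2 : ℝ) ^ (D + 1) := by
            rw [Finset.prod_const, ← pow_mul]
            have h1 : ((nb B).powerset.filter (fun U : Finset V => ∀ x ∈ B, Expl (U : Set V) x)).card ≤
                2 ^ ((D + 1) * B.card) := by
              refine (Finset.card_filter_le _ _).trans ?_
              rw [Finset.card_powerset]
              exact Nat.pow_le_pow_right (by norm_num) (hnb B)
            exact_mod_cast h1
          rw [nsmul_eq_mul]
          have hpos : 0 ≤ ε ^ N.card * (∏ _x ∈ A \ B, ε) *
                ∏ x ∈ B, (Real.exp (-(s * h x)) * Real.exp (-(s * c))) := by positivity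
          refine (mul_le_mul_of_nonneg_right hc1 hpos).trans ?_
          have e2 : (∏ _x ∈ B, (2 : ℝ) ^ (D + 1)) * (ε ^ N.card * (∏ _x ∈ A \ B, ε) *
                ∏ x ∈ B, (Real.exp (-(s * h x)) * Real.exp (-(s * c)))) =
              ε ^ N.card * ((∏ x ∈ B, (Real.exp (-(s * h x)) *
                (2 ^ (D + 1) * Real.exp (-(s * c))))) * ∏ _x ∈ A \ B, ε) := by
            rw [show (∏ x ∈ B, (Real.exp (-(s * h x)) * (2 ^ (D + 1) * Real.exp (-(s * c))))) =
              (∏ _x ∈ B, (2 : ℝ) ^ (D + 1)) *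
                ∏ x ∈ B, (Real.exp (-(s * h x)) * Real.exp (-(s * c))) by
              rw [← Finset.prod_mul_distrib]
              exact Finset.prod_congr rfl fun x _ => by ring]
            ring
          rw [e2]
          refine mul_le_mul_of_nonneg_left (mul_le_mul_of_nonneg_right ?_
            (Finset.prod_nonneg fun _ _ => hε0)) (by positivity)
          refine Finset.prod_le_prod (fun x _ => by positivity) fun x _ => ?_
          rw [div_eq_mul_one_div]
          exact mul_le_mul_of_nonneg_left hs (Real.exp_pos _).le
      _ = ε ^ N.card * ∏ x ∈ A, (Real.exp (-(s * h x)) / 2 + ε) := by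
          rw [← Finset.mul_sum, Finset.prod_add]
      _ ≤ ε ^ N.card * ∏ x ∈ A, Real.exp (-(s * h x)) := by
          refine mul_le_mul_of_nonneg_left (Finset.prod_le_prod (fun x _ => by positivity)
            fun x _ => ?_) (by positivity)
          linarith [hε x]

theorem exists_noise_of_potential {V : Type*} (G : SimpleGraph V) [G.LocallyFinite] {D : ℕ}
    (hD : ∀ x, G.degree x ≤ D) (Expl : Set V → V → Prop)
    (hloc : ∀ (U W : Set V) (x : V), (∀ y, (y = x ∨ G.Adj x y) → y ∈ U → y ∈ W) →
      Expl U x → Expl W x)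
    (h : V → ℝ) (c h₀ M : ℝ) (hc : 0 < c) (hh₀ : 0 < h₀) (hh : ∀ x, h₀ ≤ h x) (hM : ∀ x, h x ≤ M)
    (hpot : ∀ B U : Finset V, (∀ x ∈ B, Expl (U : Set V) x) → ∑ x ∈ B, (h x + c) ≤ ∑ x ∈ U, h x)
    (Z : ℝ → (V × ℕ → I) → ℕ → Set V) (hZ0 : ∀ ε L x, x ∉ Z ε L 0)
    (hZ : ∀ ε L t x, x ∈ Z ε L (t + 1) → (L (x, t + 1) : ℝ) < ε ∨ Expl (Z ε L t) x) :
    ∃ ε : ℝ, 0 < ε ∧ ε ≤ 1 ∧ ∀ x t, (noiseLaw V).real {L | x ∈ Z ε L t} ≤ 1 / 2 := by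
  let s : ℝ := (D + 2) / c + 1 / h₀
  have hs0 : 0 ≤ s := by positivity
  have hsc : (D + 2 : ℝ) ≤ s * c := by
    have : s * c = (D + 2) + c / h₀ := by simp only [s]; field_simp
    rw [this]
    have : 0 < c / h₀ := by positivity
    linarith
  have two_le : (2 : ℝ) ≤ Real.exp 1 := by linarith [Real.add_one_le_exp (1 : ℝ)]
  have hs : 2 ^ (D + 1) * Real.exp (-(s * c)) ≤ 1 / 2 := by
    rw [Real.exp_neg, ← div_eq_mul_inv, div_le_iff₀ (Real.exp_pos _)]
    have h1 : (2 : ℝ) ^ (D + 2) ≤ Real.exp (s * c) := by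
      calc (2 : ℝ) ^ (D + 2) ≤ Real.exp 1 ^ (D + 2) := pow_le_pow_left₀ (by norm_num) two_le _
        _ = Real.exp (D + 2) := by rw [← Real.exp_nat_mul]; push_cast; ring_nf
        _ ≤ _ := Real.exp_le_exp.2 hsc
    rw [pow_succ] at h1
    linarith
  have hM0 : 0 ≤ M ∨ IsEmpty V := by
    rcases isEmpty_or_nonempty V with hV | ⟨⟨x⟩⟩
    · exact Or.inr hV
    · exact Or.inl (hh₀.le.trans ((hh x).trans (hM x)))
  rcases hM0 with hM0 | hV
  swap
  · exact ⟨1, one_pos, le_rfl, fun x => (IsEmpty.false x).elim⟩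
  have hε1 : Real.exp (-(s * M)) / 2 ≤ 1 := by
    have : Real.exp (-(s * M)) ≤ 1 := Real.exp_le_one_iff.2 (by nlinarith)
    linarith
  refine ⟨Real.exp (-(s * M)) / 2, by positivity, hε1, fun x t => ?_⟩
  have key := noiseLaw_zeros_le G hD Expl hloc h c s (Real.exp (-(s * M)) / 2) (by positivity) hε1
    hpot hs0 hs (fun x => by
      have : Real.exp (-(s * M)) ≤ Real.exp (-(s * h x)) :=
        Real.exp_le_exp.2 (by nlinarith [hM x])
      linarith) (Z _) (hZ0 _) (hZ _) t ∅ {x} (by simp)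
  simp only [noisy, Finset.notMem_empty, false_imp_iff, implies_true, Set.mem_ofPred_eq, true_and,
    Finset.mem_singleton, forall_eq, Finset.card_empty, pow_zero, one_mul,
    Finset.prod_singleton] at key
  refine key.trans ?_
  have h1 : 1 ≤ s * h x := by
    have h2 : 1 / h₀ ≤ s := by simp only [s]; linarith [show 0 ≤ (D + 2 : ℝ) / c by positivity]
    calc 1 = 1 / h₀ * h₀ := by field_simp
      _ ≤ s * h₀ := mul_le_mul_of_nonneg_right h2 hh₀.le
      _ ≤ s * h x := mul_le_mul_of_nonneg_left (hh x) hs0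
  calc Real.exp (-(s * h x)) ≤ Real.exp (-1) := Real.exp_le_exp.2 (by linarith)
    _ = 1 / Real.exp 1 := by rw [Real.exp_neg, one_div]
    _ ≤ 1 / 2 := one_div_le_one_div_of_le (by norm_num) two_le

/-! ### Isoperimetric potentials -/

theorem outDeg_le_degree {V : Type*} (G : SimpleGraph V) [G.LocallyFinite] (U : Set V) (x : V) :
    outDeg G U x ≤ G.degree x := by
  classical
  unfold outDeg
  exact (Finset.card_filter_le _ _).trans (SimpleGraph.card_neighborFinset_eq_degree _ _).le

theorem edgeExpansion_mul_card_le {V : Type*} (G : SimpleGraph V) [G.LocallyFinite]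
    (K : Finset V) : edgeExpansion G * K.card ≤ ∑ x ∈ K, (outDeg G K x : ℝ) := by
  classical
  rcases K.eq_empty_or_nonempty with rfl | hK
  · simp
  have h1 : edgeExpansion G ≤ ((edgeBoundary G (K : Set V)).ncard : ℝ) / (K.card : ℝ) :=
    ciInf_le (f := fun K : {K : Finset V // K.Nonempty} =>
      ((edgeBoundary G (K.1 : Set V)).ncard : ℝ) / (K.1.card : ℝ))
      ⟨0, by rintro _ ⟨_, rfl⟩; positivity⟩ ⟨K, hK⟩
  have hpos : (0 : ℝ) < K.card := by exact_mod_cast hK.card_pos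
  rw [le_div_iff₀ hpos] at h1
  refine h1.trans ?_
  have h2 : edgeBoundary G (K : Set V) ⊆
      ↑(K.biUnion fun x => ((G.neighborFinset x).filter (· ∉ (K : Set V))).image fun y => s(x, y)) := by
    rintro e ⟨he, x, hx, y, hy, rfl⟩
    simp only [Finset.coe_biUnion, Set.mem_iUnion, Finset.coe_image, Finset.coe_filter,
      SimpleGraph.mem_neighborFinset, Set.mem_image, Set.mem_ofPred_eq]
    exact ⟨x, hx, y, ⟨(SimpleGraph.mem_edgeSet G).1 he, hy⟩, rfl⟩
  have h3 : (edgeBoundary G (K : Set V)).ncard ≤ ∑ x ∈ K, outDeg G K x := by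
    refine (Set.ncard_le_ncard h2 (Finset.finite_toSet _)).trans ?_
    rw [Set.ncard_coe_finset]
    refine le_trans (Finset.card_biUnion_le (s := K) (t := fun x =>
      ((G.neighborFinset x).filter (· ∉ (K : Set V))).image fun y => s(x, y)))
      (Finset.sum_le_sum fun x _ => ?_)
    rw [outDeg_eq_card]
    exact Finset.card_image_le
  exact_mod_cast h3

theorem vertexExpansion_mul_card_le {V : Type*} (G : SimpleGraph V) [G.LocallyFinite]
    (K : Finset V) (W : Finset V) (hW : vertexBoundary G (K : Set V) ⊆ W) :
    vertexExpansion G * K.card ≤ W.card := by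
  rcases K.eq_empty_or_nonempty with rfl | hK
  · simp
  have h1 : vertexExpansion G ≤ ((vertexBoundary G (K : Set V)).ncard : ℝ) / (K.card : ℝ) :=
    ciInf_le (f := fun K : {K : Finset V // K.Nonempty} =>
      ((vertexBoundary G (K.1 : Set V)).ncard : ℝ) / (K.1.card : ℝ))
      ⟨0, by rintro _ ⟨_, rfl⟩; positivity⟩ ⟨K, hK⟩
  have hpos : (0 : ℝ) < K.card := by exact_mod_cast hK.card_pos
  rw [le_div_iff₀ hpos] at h1
  refine h1.trans ?_
  have := Set.ncard_le_ncard hW (Finset.finite_toSet _)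
  rw [Set.ncard_coe_finset] at this
  exact_mod_cast this

theorem edgeExpansion_le_degree {V : Type*} (G : SimpleGraph V) [G.LocallyFinite] (x : V) :
    edgeExpansion G ≤ G.degree x := by
  have h := edgeExpansion_mul_card_le G {x}
  simp only [Finset.card_singleton, Nat.cast_one, mul_one, Finset.sum_singleton] at h
  exact h.trans (by exact_mod_cast outDeg_le_degree G _ x)

/-- Under the edge expansion condition, sets explaining `B` for bootstrap percolation are larger
than `B` by a fixed factor. -/
theorem card_expand_of_edgeExpansion {V : Type*} (G : SimpleGraph V) [G.LocallyFinite] {D : ℕ}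
    (hD : ∀ x, G.degree x ≤ D) (hD0 : 0 < D) {j : ℕ}
    (B U : Finset V) (hB : ∀ x ∈ B, x ∈ (U : Set V) ∧ outDeg G (U : Set V) x < j) :
    ∑ _x ∈ B, (1 + (edgeExpansion G + 1 - j) / D) ≤ ∑ _x ∈ U, (1 : ℝ) := by
  classical
  have hDpos : (0 : ℝ) < D := by exact_mod_cast hD0
  have hBU : B ⊆ U := fun x hx => (hB x hx).1
  have h1 := edgeExpansion_mul_card_le G B
  have h2 : ∀ x ∈ B, outDeg G (B : Set V) x ≤ outDeg G (U : Set V) x +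
      ∑ y ∈ U \ B, if G.Adj x y then 1 else 0 := by
    intro x _
    rw [← Finset.card_filter]
    simp only [outDeg_eq_card]
    refine (Finset.card_le_card ?_).trans (Finset.card_union_le _ _)
    intro y
    simp only [Finset.mem_filter, SimpleGraph.mem_neighborFinset, Finset.mem_union,
      Finset.mem_sdiff, Finset.mem_coe]
    tauto
  have h3 : ∑ x ∈ B, ∑ y ∈ U \ B, (if G.Adj x y then 1 else 0) ≤ D * (U \ B).card := by
    rw [Finset.sum_comm, mul_comm, ← smul_eq_mul]
    refine Finset.sum_le_card_nsmul _ _ _ fun y _ => ?_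
    rw [← Finset.card_filter]
    refine le_trans (Finset.card_le_card ?_)
      ((SimpleGraph.card_neighborFinset_eq_degree G y).le.trans (hD y))
    intro x
    simp only [Finset.mem_filter, SimpleGraph.mem_neighborFinset]
    exact fun h => h.2.symm
  have h4 : (∑ x ∈ B, (outDeg G (B : Set V) x : ℝ)) ≤ ((j : ℝ) - 1) * B.card + D * (U \ B).card := by
    have h5 : (∑ x ∈ B, outDeg G (B : Set V) x) ≤ ∑ x ∈ B, outDeg G (U : Set V) x +
        D * (U \ B).card := by
      refine (Finset.sum_le_sum h2).trans ?_
      rw [Finset.sum_add_distrib]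
      exact Nat.add_le_add_left h3 _
    have h6 : (∑ x ∈ B, (outDeg G (U : Set V) x : ℝ)) ≤ ((j : ℝ) - 1) * B.card := by
      rw [mul_comm, ← nsmul_eq_mul]
      refine Finset.sum_le_card_nsmul _ _ _ fun x hx => ?_
      have : (outDeg G (U : Set V) x : ℝ) + 1 ≤ j := by exact_mod_cast (hB x hx).2
      linarith
    have h7 : (∑ x ∈ B, (outDeg G (B : Set V) x : ℝ)) ≤ (∑ x ∈ B, (outDeg G (U : Set V) x : ℝ)) +
        D * (U \ B).card := by exact_mod_cast h5
    linarith
  have h8 : ((U \ B).card : ℝ) = U.card - B.card := by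
    rw [Finset.card_sdiff_of_subset hBU, Nat.cast_sub (Finset.card_le_card hBU)]
  rw [Finset.sum_const, Finset.sum_const, nsmul_eq_mul, nsmul_eq_mul, mul_one]
  have h9 : (edgeExpansion G + 1 - j) * B.card ≤ D * (U.card - B.card) := by
    rw [← h8]; linarith
  have h10 : (edgeExpansion G + 1 - j) * B.card / D ≤ U.card - B.card := by
    rw [div_le_iff₀ hDpos]; linarith
  calc (B.card : ℝ) * (1 + (edgeExpansion G + 1 - j) / D)
      = B.card + (edgeExpansion G + 1 - j) * B.card / D := by ring
    _ ≤ U.card := by linarith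

/-- Under the vertex expansion condition, sets explaining `B` for the consensus process are
larger than `B` by a fixed factor. -/
theorem card_expand_of_vertexExpansion {V : Type*} (G : SimpleGraph V) [G.LocallyFinite] {j : ℕ}
    (B U : Finset V) (hB : ∀ x ∈ B, outDeg G (U : Set V) x < j) :
    ∑ _x ∈ B, (1 + (vertexExpansion G - j)) ≤ ∑ _x ∈ U, (1 : ℝ) := by
  classical
  have h1 := vertexExpansion_mul_card_le G B
    (U ∪ B.biUnion fun x => (G.neighborFinset x).filter (· ∉ (U : Set V))) (by
      rintro y ⟨_, x, hx, hxy⟩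
      by_cases hyU : y ∈ U
      · exact Finset.mem_coe.2 (Finset.mem_union_left _ hyU)
      · refine Finset.mem_coe.2 (Finset.mem_union_right _ (Finset.mem_biUnion.2 ⟨x, hx, ?_⟩))
        simpa [hyU] using hxy.symm)
  have h2 : (U ∪ B.biUnion fun x => (G.neighborFinset x).filter (· ∉ (U : Set V))).card ≤
      U.card + ∑ x ∈ B, outDeg G (U : Set V) x :=
    (Finset.card_union_le _ _).trans (Nat.add_le_add_left (by
      simp only [outDeg_eq_card]
      exact Finset.card_biUnion_le (s := B)
        (t := fun x => (G.neighborFinset x).filter (· ∉ (U : Set V)))) _)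
  have h6 : (∑ x ∈ B, (outDeg G (U : Set V) x : ℝ)) ≤ ((j : ℝ) - 1) * B.card := by
    rw [mul_comm, ← nsmul_eq_mul]
    refine Finset.sum_le_card_nsmul _ _ _ fun x hx => ?_
    have : (outDeg G (U : Set V) x : ℝ) + 1 ≤ j := by exact_mod_cast hB x hx
    linarith
  have h3 : ((U ∪ B.biUnion fun x => (G.neighborFinset x).filter (· ∉ (U : Set V))).card : ℝ) ≤
      U.card + ∑ x ∈ B, (outDeg G (U : Set V) x : ℝ) := by exact_mod_cast h2
  rw [Finset.sum_const, Finset.sum_const, nsmul_eq_mul, nsmul_eq_mul, mul_one]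
  linarith

theorem outDeg_eq_sum {V : Type*} (G : SimpleGraph V) [G.LocallyFinite] (U : Finset V) (x : V) :
    (outDeg G (U : Set V) x : ℝ) =
      G.degree x - (by classical exact ∑ y ∈ U, if G.Adj x y then 1 else 0) := by
  classical
  have h1 : outDeg G (U : Set V) x + ∑ y ∈ U, (if G.Adj x y then 1 else 0) = G.degree x := by
    have h2 : U.filter (G.Adj x ·) = (G.neighborFinset x).filter (¬ · ∉ (U : Set V)) := by
      ext y
      simp [and_comm]
    rw [← Finset.card_filter, ← SimpleGraph.card_neighborFinset_eq_degree,
      ← Finset.card_filter_add_card_filter_not (s := G.neighborFinset x) (· ∉ (U : Set V)), h2,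
      outDeg_eq_card]
  rw [← h1]
  push_cast
  simp

theorem sum_outDeg_swap {V : Type*} (G : SimpleGraph V) [G.LocallyFinite] (A U : Finset V) :
    ∑ x ∈ U, (outDeg G (A : Set V) x : ℝ) = ∑ x ∈ U, (G.degree x : ℝ) - ∑ x ∈ A, (G.degree x : ℝ) +
      ∑ x ∈ A, (outDeg G (U : Set V) x : ℝ) := by
  classical
  simp_rw [outDeg_eq_sum, Finset.sum_sub_distrib]
  rw [Finset.sum_comm (s := U) (t := A)]
  simp_rw [G.adj_comm]
  ring

theorem sum_outDeg_union_inter_le {V : Type*} [DecidableEq V] (G : SimpleGraph V)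
    [G.LocallyFinite] (A U : Finset V) :
    ∑ x ∈ A ∪ U, (outDeg G (↑(A ∪ U) : Set V) x : ℝ) +
        ∑ x ∈ A ∩ U, (outDeg G (↑(A ∩ U) : Set V) x : ℝ) ≤
      ∑ x ∈ A, (outDeg G (U : Set V) x : ℝ) + ∑ x ∈ U, (outDeg G (A : Set V) x : ℝ) := by
  have hinter : ∀ x, outDeg G (↑(A ∪ U) : Set V) x + outDeg G (↑(A ∩ U) : Set V) x =
      outDeg G (U : Set V) x + outDeg G (A : Set V) x := by
    classical
    intro x
    simp only [outDeg_eq_card]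
    rw [← Finset.card_union_add_card_inter ((G.neighborFinset x).filter (· ∉ (U : Set V)))
      ((G.neighborFinset x).filter (· ∉ (A : Set V))), ← Finset.filter_or, ← Finset.filter_and, add_comm]
    congr 2 <;> ext y <;> simp <;> tauto
  have hU : ∀ x, outDeg G (↑(A ∪ U) : Set V) x ≤ outDeg G (U : Set V) x := fun x =>
    outDeg_mono G fun y _ hy => by simpa using Or.inr hy
  have hA : ∀ x, outDeg G (↑(A ∪ U) : Set V) x ≤ outDeg G (A : Set V) x := fun x =>
    outDeg_mono G fun y _ hy => by simpa using Or.inl hy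
  have key : ∑ x ∈ A ∪ U, (outDeg G (↑(A ∪ U) : Set V) x) +
        ∑ x ∈ A ∩ U, (outDeg G (↑(A ∩ U) : Set V) x) ≤
      ∑ x ∈ A, (outDeg G (U : Set V) x) + ∑ x ∈ U, (outDeg G (A : Set V) x) := by
    have e1 : ∀ f : V → ℕ, ∑ x ∈ A, f x = ∑ x ∈ A ∪ U, if x ∈ A then f x else 0 := fun f => by
      rw [← Finset.sum_filter]; congr 1; ext y; simp
    have e2 : ∀ f : V → ℕ, ∑ x ∈ U, f x = ∑ x ∈ A ∪ U, if x ∈ U then f x else 0 := fun f => by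
      rw [← Finset.sum_filter]; congr 1; ext y; simp
    have e3 : ∀ f : V → ℕ, ∑ x ∈ A ∩ U, f x = ∑ x ∈ A ∪ U, if x ∈ A ∧ x ∈ U then f x else 0 :=
      fun f => by rw [← Finset.sum_filter]; congr 1; ext y; simp; tauto
    rw [e1, e2, e3, ← Finset.sum_add_distrib, ← Finset.sum_add_distrib]
    refine Finset.sum_le_sum fun x hx => ?_
    have h1 := hinter x
    have h2 := hU x
    have h3 := hA x
    rcases Finset.mem_union.1 hx with h | h
    · by_cases h' : x ∈ U
      · simp only [h, h', and_self, if_true]; omega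
      · simp only [h, h', and_false, if_true, if_false]; omega
    · by_cases h' : x ∈ A
      · simp only [h, h', and_self, if_true]; omega
      · simp only [h, h', false_and, if_true, if_false]; omega
  exact_mod_cast key

/-- Under the edge expansion condition, the potential `deg - Φ_E` of a set explaining `B` for the
consensus process exceeds that of `B`. -/
theorem potential_of_edgeExpansion {V : Type*} (G : SimpleGraph V) [G.LocallyFinite] {j : ℕ}
    (B U : Finset V) (hB : ∀ x ∈ B, outDeg G (U : Set V) x < j) :
    ∑ x ∈ B, ((G.degree x - edgeExpansion G + (edgeExpansion G + 1 - j)) +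
        (edgeExpansion G + 1 - j)) ≤
      ∑ x ∈ U, ((G.degree x : ℝ) - edgeExpansion G) := by
  classical
  have h1 := edgeExpansion_mul_card_le G (B ∪ U)
  have h2 := edgeExpansion_mul_card_le G (B ∩ U)
  have h3 := sum_outDeg_union_inter_le G B U
  have h4 := sum_outDeg_swap G B U
  have h5 : ((B ∪ U).card : ℝ) + (B ∩ U).card = B.card + U.card := by
    exact_mod_cast Finset.card_union_add_card_inter B U
  have h6 : (∑ x ∈ B, (outDeg G (U : Set V) x : ℝ)) ≤ ((j : ℝ) - 1) * B.card := by
    rw [mul_comm, ← nsmul_eq_mul]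
    refine Finset.sum_le_card_nsmul _ _ _ fun x hx => ?_
    have : (outDeg G (U : Set V) x : ℝ) + 1 ≤ j := by exact_mod_cast hB x hx
    linarith
  have h7 : edgeExpansion G * (B.card + U.card) ≤ 2 * (((j : ℝ) - 1) * B.card) +
      ∑ x ∈ U, (G.degree x : ℝ) - ∑ x ∈ B, (G.degree x : ℝ) := by
    rw [← h5, mul_add]; linarith
  simp only [Finset.sum_add_distrib, Finset.sum_sub_distrib, Finset.sum_const, nsmul_eq_mul]
  linarith

theorem bpThreshold_pos_of_edgeExpansion {V : Type*} (G : SimpleGraph V) [G.LocallyFinite]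
    (hconn : G.Connected) {D : ℕ} (hD : ∀ x, G.degree x ≤ D) {j : ℕ}
    (hj : (j : ℝ) < edgeExpansion G + 1) : 0 < bpThreshold G j := by
  obtain ⟨ε, h0, h1, h⟩ := exists_noise_of_potential G (D := D + 1)
    (fun x => (hD x).trans (Nat.le_succ D)) (fun U x => x ∈ U ∧ outDeg G U x < j)
    (fun U W x h hx => ⟨h x (Or.inl rfl) hx.1,
      (outDeg_mono G fun y hy => h y (Or.inr hy)).trans_lt hx.2⟩)
    (fun _ => 1) ((edgeExpansion G + 1 - j) / (D + 1 : ℕ)) 1 1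
    (div_pos (by linarith) (by positivity)) one_pos (fun _ => le_rfl) (fun _ => le_rfl)
    (fun B U hBU => card_expand_of_edgeExpansion G (fun x => (hD x).trans (Nat.le_succ D))
      (Nat.succ_pos D) B U hBU)
    (fun ε => zeros (bpStep G j ε)) (fun ε => not_mem_zeros_zero _)
    (fun ε => mem_zeros_bpStep_succ G j ε)
  obtain ⟨r⟩ := hconn.nonempty
  exact bpThreshold_pos G hconn j ε h0 h1 r (h r)

theorem cpThreshold_pos_of_vertexExpansion {V : Type*} (G : SimpleGraph V) [G.LocallyFinite]
    (hconn : G.Connected) {D : ℕ} (hD : ∀ x, G.degree x ≤ D) {j : ℕ}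
    (hj : (j : ℝ) < vertexExpansion G) : 0 < cpThreshold G j := by
  obtain ⟨ε, h0, h1, h⟩ := exists_noise_of_potential G hD (fun U x => outDeg G U x < j)
    (fun U W x h hx => (outDeg_mono G fun y hy => h y (Or.inr hy)).trans_lt hx)
    (fun _ => 1) (vertexExpansion G - j) 1 1
    (by linarith) one_pos (fun _ => le_rfl) (fun _ => le_rfl)
    (fun B U hBU => card_expand_of_vertexExpansion G B U hBU)
    (fun ε => zeros (cpStep G j ε)) (fun ε => not_mem_zeros_zero _)
    (fun ε => mem_zeros_cpStep_succ G j ε)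
  obtain ⟨r⟩ := hconn.nonempty
  exact cpThreshold_pos G hconn j ε h0 h1 r (h r)

theorem cpThreshold_pos_of_edgeExpansion {V : Type*} (G : SimpleGraph V) [G.LocallyFinite]
    (hconn : G.Connected) {D : ℕ} (hD : ∀ x, G.degree x ≤ D) {j : ℕ}
    (hj : (j : ℝ) < edgeExpansion G + 1) : 0 < cpThreshold G j := by
  obtain ⟨ε, h0, h1, h⟩ := exists_noise_of_potential G hD (fun U x => outDeg G U x < j)
    (fun U W x h hx => (outDeg_mono G fun y hy => h y (Or.inr hy)).trans_lt hx)
    (fun x => G.degree x - edgeExpansion G + (edgeExpansion G + 1 - j))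
    (edgeExpansion G + 1 - j) (edgeExpansion G + 1 - j) (D + 1)
    (by linarith) (by linarith) (fun x => by linarith [edgeExpansion_le_degree G x])
    (fun x => by
      have : (G.degree x : ℝ) ≤ D := by exact_mod_cast hD x
      have : (0 : ℝ) ≤ j := by positivity
      linarith)
    (fun B U hBU => by
      refine (potential_of_edgeExpansion G B U hBU).trans ?_
      exact Finset.sum_le_sum fun x _ => by linarith)
    (fun ε => zeros (cpStep G j ε)) (fun ε => not_mem_zeros_zero _)
    (fun ε => mem_zeros_cpStep_succ G j ε)
  obtain ⟨r⟩ := hconn.nonempty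
  exact cpThreshold_pos G hconn j ε h0 h1 r (h r)

theorem edgeExpansion_le_supDegree {V : Type*} [Nonempty V] (G : SimpleGraph V) [G.LocallyFinite]
    (hΔ : BddAbove (Set.range fun x => G.degree x)) : edgeExpansion G ≤ supDegree G := by
  obtain ⟨r⟩ := ‹Nonempty V›
  refine (edgeExpansion_le_degree G r).trans ?_
  exact_mod_cast le_ciSup hΔ r

/-! ### Sums over lists -/

theorem tsum_list_le {α : Type*} (f : List α → ENNReal) :
    ∑' l, f l ≤ f [] + ∑' a, ∑' l, f (a :: l) := by
  classical
  rw [← ENNReal.tsum_prod]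
  have h1 : ∀ l : List α, f l ≤ (if l = [] then f [] else 0) +
      ∑' p : α × List α, if l = p.1 :: p.2 then f (p.1 :: p.2) else 0 := by
    rintro (_ | ⟨a, l⟩)
    · simp
    · refine le_add_left (le_trans ?_ (ENNReal.le_tsum (a, l)))
      simp
  refine (ENNReal.tsum_le_tsum h1).trans ?_
  rw [ENNReal.tsum_add, ENNReal.tsum_comm]
  simp_rw [tsum_ite_eq]
  exact le_rfl

/-- The product of the weights along the path `a :: l`. -/
noncomputable def pathWeight {α : Type*} (w : α → α → ENNReal) : α → List α → ENNReal
  | _, [] => 1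
  | a, b :: l => w a b * pathWeight w b l

theorem tsum_pathWeight_le {α : Type*} (w : α → α → ENNReal) (K : ENNReal)
    (h : ∀ a, K * ∑' b, w a b ≤ 2⁻¹) (a : α) :
    ∑' l : List α, K ^ l.length * pathWeight w a l ≤ 2 := by
  have key : ∀ (n : ℕ) (a : α),
      ∑' l : List α, (if l.length ≤ n then K ^ l.length * pathWeight w a l else 0) ≤ 2 := by
    intro n
    induction n with
    | zero =>
      intro a
      refine (tsum_list_le _).trans ?_
      simp [pathWeight]
    | succ n ih =>
      intro a
      refine (tsum_list_le _).trans ?_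
      have h1 : ∀ b, ∑' l : List α, (if (b :: l).length ≤ n + 1 then
          K ^ (b :: l).length * pathWeight w a (b :: l) else 0) ≤ K * w a b * 2 := by
        intro b
        refine le_trans ?_ (mul_le_mul_right (ih b) (K * w a b))
        rw [← ENNReal.tsum_mul_left]
        refine ENNReal.tsum_le_tsum fun l => ?_
        simp only [List.length_cons, add_le_add_iff_right, pathWeight]
        split_ifs
        · rw [pow_succ]
          apply le_of_eq
          ring
        · simp
      refine (add_le_add le_rfl (ENNReal.tsum_le_tsum h1)).trans ?_
      rw [ENNReal.tsum_mul_right, ENNReal.tsum_mul_left]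
      simp only [List.length_nil, zero_le, if_true, pow_zero, pathWeight, mul_one]
      calc 1 + K * (∑' b, w a b) * 2 ≤ 1 + 2⁻¹ * 2 := by gcongr; exact h a
        _ = 2 := by
          rw [ENNReal.inv_mul_cancel (by norm_num) (by norm_num)]; norm_num
  rw [ENNReal.tsum_eq_iSup_sum]
  refine iSup_le fun s => ?_
  obtain ⟨n, hn⟩ : ∃ n, ∀ l ∈ s, l.length ≤ n :=
    ⟨s.sup List.length, fun l hl => Finset.le_sup hl⟩
  refine le_trans ?_ (key n a)
  refine le_trans (le_of_eq (Finset.sum_congr rfl fun l hl => ?_)) (ENNReal.sum_le_tsum s)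
  rw [if_pos (hn l hl)]

/-- A path of a relation can be made free of repetitions. -/
theorem exists_nodup_chain {α : Type*} {R : α → α → Prop} {a b : α}
    (h : Relation.ReflTransGen R a b) :
    ∃ l : List α, List.IsChain R (a :: l) ∧ (a :: l).getLast (List.cons_ne_nil _ _) = b ∧
      (a :: l).Nodup := by
  induction h using Relation.ReflTransGen.head_induction_on with
  | refl => exact ⟨[], by simp, by simp, by simp⟩
  | @head a c hac hcb ih =>
    obtain ⟨l, h1, h2, h3⟩ := ih
    by_cases ha : a ∈ c :: l
    · obtain ⟨l₁, l₂, hl⟩ := List.append_of_mem ha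
      refine ⟨l₂, ?_, ?_, ?_⟩
      · rw [hl] at h1; exact h1.right_of_append
      · rw [← h2]; simp [hl]
      · rw [hl] at h3; exact (List.nodup_append.1 h3).2.1
    · exact ⟨c :: l, List.isChain_cons_cons.2 ⟨hac, h1⟩, by simpa using h2,
        List.nodup_cons.2 ⟨ha, h3⟩⟩

/-! ### Toom contours for explanations moving outwards -/

/-- `z` and `z'` are consecutive sinks of a contour: their connecting arc goes up `c` steps towards
smaller `f` from `z`, makes one step to larger `f` and then `c'` steps down in time to `z'`. -/
def ContourArc {V : Type*} (G : SimpleGraph V) (f : V → ℕ) (c c' : ℕ) (z z' : V × ℕ) : Prop :=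
  ∃ (y : V) (p : G.Walk z.1 y), p.length = c ∧ f z.1 = f y + c ∧ G.Adj y z'.1 ∧
    f z'.1 = f y + 1 ∧ z'.2 + c' = z.2 + c

theorem exists_contour {V : Type*} (G : SimpleGraph V) (f : V → ℕ) (Z : ℕ → Set V)
    (noise : V × ℕ → Prop) (hZ0 : ∀ x, x ∉ Z 0)
    (hZ : ∀ t x, x ∈ Z (t + 1) → noise (x, t + 1) ∨
      (x ∈ Z t ∧ ∃ y, G.Adj x y ∧ f y = f x + 1 ∧ y ∈ Z t)) (t : ℕ) :
    ∀ x ∈ Z t, ∃ a b : V × ℕ, Relation.ReflTransGen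
        (fun z z' => noise z' ∧ ∃ c c', ContourArc G f c c' z z') a b ∧
      noise a ∧ a.1 = x ∧ a.2 ≤ t ∧
      ∃ p : G.Walk x b.1, f b.1 = f x + p.length ∧ b.2 + p.length = t := by
  induction t with
  | zero => exact fun x hx => (hZ0 x hx).elim
  | succ t ih =>
    intro x hx
    rcases hZ t x hx with h | ⟨hxt, y, hxy, hfy, hyt⟩
    · exact ⟨(x, t + 1), (x, t + 1), .refl, h, rfl, le_rfl, .nil, by simp⟩
    · obtain ⟨a₁, b₁, hab₁, ha₁, hax, hat, p₁, hp₁, hpt₁⟩ := ih x hxt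
      obtain ⟨a₂, b₂, hab₂, ha₂, hay, hat₂, p₂, hp₂, hpt₂⟩ := ih y hyt
      refine ⟨a₁, b₂, (hab₁.tail ⟨ha₂, p₁.length, t - a₂.2, x, p₁.reverse, by simp, hp₁, ?_, ?_, ?_⟩).trans
        hab₂, ha₁, hax, by omega, .cons hxy p₂, ?_, ?_⟩
      · rwa [hay]
      · rwa [hay]
      · omega
      · rw [SimpleGraph.Walk.length_cons]; omega
      · rw [SimpleGraph.Walk.length_cons]; omega

/-- The weight of all arcs from `z` to `z'`. -/
noncomputable def arcWeight {V : Type*} (G : SimpleGraph V) (f : V → ℕ) (r : ENNReal)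
    (z z' : V × ℕ) : ENNReal := by
  classical exact ∑' c : ℕ, ∑' c' : ℕ, if ContourArc G f c c' z z' then r ^ (c + c') else 0

theorem exists_pow_le_pathWeight {V : Type*} (G : SimpleGraph V) (f : V → ℕ) (r : ENNReal)
    (l : List (V × ℕ)) : ∀ (a : V × ℕ),
      List.IsChain (fun z z' => ∃ c c', ContourArc G f c c' z z') (a :: l) →
      ∃ S : ℕ, r ^ S ≤ pathWeight (arcWeight G f r) a l ∧
        S + 2 * f ((a :: l).getLast (List.cons_ne_nil _ _)).1 +
          ((a :: l).getLast (List.cons_ne_nil _ _)).2 = 2 * l.length + 2 * f a.1 + a.2 := by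
  classical
  induction l with
  | nil => exact fun a _ => ⟨0, by simp [pathWeight], by simp⟩
  | cons b l ih =>
    intro a h
    obtain ⟨⟨c, c', hcc⟩, h2⟩ := List.isChain_cons_cons.1 h
    obtain ⟨S, hS1, hS2⟩ := ih b h2
    refine ⟨c + c' + S, ?_, ?_⟩
    · rw [pow_add, pathWeight]
      refine mul_le_mul' ?_ hS1
      refine le_trans ?_ (ENNReal.le_tsum c)
      refine le_trans ?_ (ENNReal.le_tsum c')
      rw [if_pos hcc]
    · obtain ⟨y, p, hp, h3, h4, h5, h6⟩ := hcc
      rw [List.getLast_cons (List.cons_ne_nil _ _), List.length_cons]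
      omega

theorem tsum_arcWeight_le {V : Type*} (G : SimpleGraph V) [G.LocallyFinite] {D : ℕ}
    (hD : ∀ x, G.degree x ≤ D) (hD0 : 1 ≤ D) (f : V → ℕ) (z : V × ℕ) :
    ∑' z', arcWeight G f (2 * D : ENNReal)⁻¹ z z' ≤ 4 * D := by
  classical
  unfold arcWeight
  set r : ENNReal := (2 * D : ENNReal)⁻¹
  have hDne : (D : ENNReal) ≠ 0 := by exact_mod_cast (by omega : D ≠ 0)
  have hDtop : (D : ENNReal) ≠ ⊤ := ENNReal.natCast_ne_top D
  have hrD : r * D = 2⁻¹ := by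
    simp only [r]
    rw [ENNReal.mul_inv (Or.inl (by norm_num)) (Or.inl (by norm_num)), mul_assoc,
      ENNReal.inv_mul_cancel hDne hDtop, mul_one]
  have hr2 : r ≤ 2⁻¹ := by
    rw [← hrD]
    exact le_mul_of_one_le_right' (by exact_mod_cast hD0)
  have hcount : ∀ c c' : ℕ, ∑' z', (if ContourArc G f c c' z z' then r ^ (c + c') else 0) ≤
      (D : ENNReal) * (2⁻¹ ^ c * 2⁻¹ ^ c') := by
    intro c c'
    let F : Finset (V × ℕ) := (walkEnds G (c + 1) z.1).image fun x => (x, z.2 + c - c')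
    have hF : F.card ≤ D ^ (c + 1) := Finset.card_image_le.trans (card_walkEnds_le G hD _ _)
    have h1 : ∀ z', (if ContourArc G f c c' z z' then r ^ (c + c') else 0) ≤
        if z' ∈ F then r ^ (c + c') else 0 := by
      intro z'
      split_ifs with h h'
      · exact le_rfl
      · exfalso
        apply h'
        obtain ⟨y, p, hp, h3, h4, h5, h6⟩ := h
        refine Finset.mem_image.2 ⟨z'.1, ?_, ?_⟩
        · have := mem_walkEnds (p.concat h4)
          rwa [SimpleGraph.Walk.length_concat, hp] at this
        · exact Prod.ext rfl (by simp only; omega)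
      · exact zero_le
      · exact le_rfl
    refine (ENNReal.tsum_le_tsum h1).trans ?_
    rw [tsum_eq_sum (s := F) (fun z' hz' => if_neg hz')]
    rw [Finset.sum_ite_mem, Finset.inter_self, Finset.sum_const, nsmul_eq_mul]
    calc (F.card : ENNReal) * r ^ (c + c') ≤ (D ^ (c + 1) : ENNReal) * r ^ (c + c') := by
          gcongr; exact_mod_cast hF
      _ = D * ((r * D) ^ c * r ^ c') := by rw [mul_pow]; ring
      _ ≤ D * (2⁻¹ ^ c * 2⁻¹ ^ c') := by rw [hrD]; gcongr
  rw [ENNReal.tsum_comm]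
  have hgeo : ∑' n : ℕ, (2⁻¹ : ENNReal) ^ n = 2 := by
    rw [ENNReal.tsum_geometric, ENNReal.one_sub_inv_two, inv_inv]
  calc ∑' c, ∑' z', ∑' c', (if ContourArc G f c c' z z' then r ^ (c + c') else 0)
      = ∑' c, ∑' c', ∑' z', (if ContourArc G f c c' z z' then r ^ (c + c') else 0) := by
        congr 1; funext c; rw [ENNReal.tsum_comm]
    _ ≤ ∑' c, ∑' c', (D : ENNReal) * (2⁻¹ ^ c * 2⁻¹ ^ c') :=
        ENNReal.tsum_le_tsum fun c => ENNReal.tsum_le_tsum fun c' => hcount c c'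
    _ = 4 * D := by
        simp_rw [ENNReal.tsum_mul_left, ENNReal.tsum_mul_right, hgeo]
        rw [mul_comm]
        norm_num

theorem noiseLaw_zeros_le_of_outward {V : Type*} [Countable V] (G : SimpleGraph V)
    [G.LocallyFinite] {D : ℕ} (hD : ∀ x, G.degree x ≤ D) (hD0 : 1 ≤ D) (f : V → ℕ)
    (ε : ℝ) (hε : ε = 1 / (64 * D ^ 3))
    (Z : (V × ℕ → I) → ℕ → Set V) (hZ0 : ∀ L x, x ∉ Z L 0)
    (hZ : ∀ L t x, x ∈ Z L (t + 1) → (L (x, t + 1) : ℝ) < ε ∨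
      (x ∈ Z L t ∧ ∃ y, G.Adj x y ∧ f y = f x + 1 ∧ y ∈ Z L t)) (x : V) (t : ℕ) :
    (noiseLaw V).real {L | x ∈ Z L t} ≤ 1 / 2 := by
  classical
  have hDr : (1 : ℝ) ≤ D := by exact_mod_cast hD0
  have hε0 : 0 ≤ ε := by rw [hε]; positivity
  have hε1 : ε ≤ 1 := by
    rw [hε, div_le_one (by positivity)]
    nlinarith [one_le_pow₀ hDr (n := 3)]
  set r : ENNReal := (2 * D : ENNReal)⁻¹ with hr
  set K : ENNReal := (16 * D : ENNReal)⁻¹ with hK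
  have hDne : (D : ENNReal) ≠ 0 := by exact_mod_cast (by omega : D ≠ 0)
  have hDtop : (D : ENNReal) ≠ ⊤ := ENNReal.natCast_ne_top D
  have hεK : ENNReal.ofReal ε = K * r ^ 2 := by
    have hD' : (0 : ℝ) < D := by linarith
    rw [hε, hK, hr]
    have e1 : (16 * D : ENNReal) = ENNReal.ofReal (16 * D) := by
      rw [ENNReal.ofReal_mul (by norm_num)]; simp
    have e2 : (2 * D : ENNReal) = ENNReal.ofReal (2 * D) := by
      rw [ENNReal.ofReal_mul (by norm_num)]; simp
    rw [e1, e2, ← ENNReal.ofReal_inv_of_pos (by positivity),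
      ← ENNReal.ofReal_inv_of_pos (by positivity), ← ENNReal.ofReal_pow (by positivity),
      ← ENNReal.ofReal_mul (by positivity)]
    congr 1
    field_simp
    norm_num
  have hKw : ∀ a, K * ∑' b, arcWeight G f r a b ≤ 2⁻¹ := by
    intro a
    refine (mul_le_mul_right (tsum_arcWeight_le G hD hD0 f a) K).trans ?_
    rw [hK, ENNReal.mul_inv (Or.inl (by norm_num)) (Or.inl (by norm_num))]
    calc (16 : ENNReal)⁻¹ * (D : ENNReal)⁻¹ * (4 * D) = 16⁻¹ * 4 * ((D : ENNReal)⁻¹ * D) := by ring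
      _ = 16⁻¹ * 4 := by rw [ENNReal.inv_mul_cancel hDne hDtop, mul_one]
      _ ≤ 2⁻¹ := by
        rw [ENNReal.inv_mul_le_iff (by norm_num) (by norm_num), ← div_eq_mul_inv,
          ENNReal.le_div_iff_mul_le (by norm_num) (by norm_num)]
        norm_num
  have hr1 : r ≤ 2⁻¹ := by
    rw [hr, ENNReal.inv_le_inv]
    exact le_mul_of_one_le_right' (by exact_mod_cast hD0)
  have hr1' : r ≤ 1 := hr1.trans (by rw [ENNReal.inv_le_one]; norm_num)
  let Adm : ℕ → List (V × ℕ) → Prop := fun d l => ∃ a : V × ℕ, a = (x, t - d) ∧ (a :: l).Nodup ∧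
    r ^ (2 * l.length) ≤ r ^ d * pathWeight (arcWeight G f r) a l
  have hsub : {L | x ∈ Z L t} ⊆ ⋃ d : ℕ, ⋃ l : List (V × ℕ),
      {L | Adm d l ∧ L ∈ noisy ε ((x, t - d) :: l).toFinset} := by
    intro L hL
    obtain ⟨a, b, hab, ha, hax, hat, p, hp, hpt⟩ := exists_contour G f (Z L)
      (fun z => (L z : ℝ) < ε) (hZ0 L) (hZ L) t x hL
    obtain ⟨l, hl1, hl2, hl3⟩ := exists_nodup_chain hab
    simp only [Set.mem_iUnion]
    have hae : a = (x, t - (t - a.2)) := Prod.ext hax (by simp only; omega)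
    refine ⟨t - a.2, l, ⟨a, hae, hl3, ?_⟩, ?_⟩
    · obtain ⟨S, hS1, hS2⟩ := exists_pow_le_pathWeight G f r l a (hl1.imp fun _ _ h => h.2)
      rw [hl2, hax] at hS2
      refine le_trans ?_ (mul_le_mul_right hS1 _)
      rw [← pow_add]
      exact pow_le_pow_right_of_le_one' hr1' (by omega)
    · rw [← hae]
      intro z hz
      rw [List.mem_toFinset] at hz
      have hall : ∀ (l : List (V × ℕ)) (a : V × ℕ), (L a : ℝ) < ε →
          List.IsChain (fun z z' => (L z' : ℝ) < ε ∧ ∃ c c', ContourArc G f c c' z z') (a :: l) →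
          ∀ z ∈ a :: l, (L z : ℝ) < ε := by
        intro l
        induction l with
        | nil => intro a ha _ z hz; rw [List.mem_singleton.1 hz]; exact ha
        | cons b l ih =>
          intro a ha h z hz
          rw [List.isChain_cons_cons] at h
          rcases List.mem_cons.1 hz with rfl | hz
          · exact ha
          · exact ih b h.1.1 h.2 z hz
      exact hall l a ha hl1 z hz
  have hterm : ∀ d l, noiseLaw V {L | Adm d l ∧ L ∈ noisy ε ((x, t - d) :: l).toFinset} ≤
      K * r ^ d * (K ^ l.length * pathWeight (arcWeight G f r) (x, t - d) l) := by
    intro d l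
    by_cases h : Adm d l
    · obtain ⟨a, rfl, hnd, hpw⟩ := id h
      simp only [h, true_and]
      change noiseLaw V (noisy ε _) ≤ _
      rw [noiseLaw_noisy hε0 hε1, List.toFinset_card_of_nodup hnd, hεK, List.length_cons]
      calc (K * r ^ 2) ^ (l.length + 1) = K * K ^ l.length * r ^ 2 * r ^ (2 * l.length) := by
            rw [mul_pow, ← pow_mul]; ring
        _ ≤ K * K ^ l.length * 1 * (r ^ d * pathWeight (arcWeight G f r) (x, t - d) l) := by
            gcongr
            exact pow_le_one' hr1' 2
        _ = _ := by ring
    · simp [h]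
  have hfinal : noiseLaw V {L | x ∈ Z L t} ≤ ENNReal.ofReal (1 / 2) := by
    calc noiseLaw V {L | x ∈ Z L t}
        ≤ ∑' d : ℕ, ∑' l : List (V × ℕ),
          noiseLaw V {L | Adm d l ∧ L ∈ noisy ε ((x, t - d) :: l).toFinset} :=
          (measure_mono hsub).trans ((measure_iUnion_le _).trans
            (ENNReal.tsum_le_tsum fun d => measure_iUnion_le _))
      _ ≤ ∑' d : ℕ, K * 2⁻¹ ^ d * 2 := by
          refine ENNReal.tsum_le_tsum fun d => (ENNReal.tsum_le_tsum (hterm d)).trans ?_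
          rw [ENNReal.tsum_mul_left]
          gcongr
          exact tsum_pathWeight_le _ K hKw _
      _ = K * 4 := by
          rw [ENNReal.tsum_mul_right, ENNReal.tsum_mul_left, ENNReal.tsum_geometric,
            ENNReal.one_sub_inv_two, inv_inv, mul_assoc]
          norm_num
      _ ≤ ENNReal.ofReal (1 / 2) := by
          have e1 : (16 * D : ENNReal) = ENNReal.ofReal (16 * D) := by
            rw [ENNReal.ofReal_mul (by norm_num)]; simp
          rw [hK, e1, ← ENNReal.ofReal_inv_of_pos (by positivity),
            show (4 : ENNReal) = ENNReal.ofReal 4 by simp, ← ENNReal.ofReal_mul (by positivity)]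
          apply ENNReal.ofReal_le_ofReal
          rw [inv_mul_le_iff₀ (by positivity)]
          linarith
  rw [measureReal_def]
  exact ENNReal.toReal_le_of_le_ofReal (by norm_num) hfinal

theorem bpThreshold_pos_of_le_jbar {V : Type*} (G : SimpleGraph V) [G.LocallyFinite]
    (hconn : G.Connected) (hΔ : BddAbove (Set.range fun x => G.degree x)) {j : ℕ}
    (hj : j ≤ jbar G) : 0 < bpThreshold G j := by
  classical
  have := hconn.nonempty
  have := countable_of_connected G hconn
  obtain ⟨r, hr⟩ := (jbar_mem G hΔ).1
  obtain ⟨D, hD⟩ := hΔ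
  have hD' : ∀ x, G.degree x ≤ D + 1 := fun x => (hD ⟨x, rfl⟩).trans (Nat.le_succ D)
  have h1 : (1 : ℝ) ≤ 64 * ((D + 1 : ℕ) : ℝ) ^ 3 := by
    have : (1 : ℝ) ≤ ((D + 1 : ℕ) : ℝ) ^ 3 := one_le_pow₀ (by push_cast; linarith [Nat.cast_nonneg (α := ℝ) D])
    linarith
  refine bpThreshold_pos G hconn j (1 / (64 * ((D + 1 : ℕ) : ℝ) ^ 3)) (by positivity)
    ((div_le_one (by positivity)).2 h1) r fun t => ?_
  refine noiseLaw_zeros_le_of_outward G hD' (by omega) (G.dist r) _ rfl _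
    (not_mem_zeros_zero _) ?_ r t
  intro L t x hx
  refine (mem_zeros_bpStep_succ G j _ L t x hx).imp id fun h => ⟨h.1, ?_⟩
  by_contra hcon
  push Not at hcon
  have h2 := hr (G.dist r x) x rfl
  have h3 : (sphere G r (G.dist r x + 1) ∩ G.neighborSet x).ncard ≤
      outDeg G (zeros (bpStep G j (1 / (64 * ((D + 1 : ℕ) : ℝ) ^ 3))) L t) x := by
    rw [outDeg_eq_card, ← Set.ncard_coe_finset]
    refine Set.ncard_le_ncard ?_ (Finset.finite_toSet _)
    rintro y ⟨hy1, hy2⟩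
    simp only [Finset.coe_filter, SimpleGraph.mem_neighborFinset, Set.mem_ofPred_eq]
    exact ⟨hy2, hcon y hy2 hy1⟩
  omega

/-! ### The weights of paths -/

/-- `1 / n ^ 2`, with value 1 at 0. -/
noncomputable def invSq (n : ℕ) : ℝ := if n = 0 then 1 else 1 / (n : ℝ) ^ 2

theorem invSq_succ (n : ℕ) : invSq (n + 1) = 1 / ((n : ℝ) + 1) ^ 2 := by
  simp [invSq]

theorem invSq_pos (n : ℕ) : 0 < invSq n := by
  unfold invSq
  split_ifs with h
  · exact one_pos
  · have : (0 : ℝ) < n := by exact_mod_cast Nat.pos_of_ne_zero h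
    positivity

theorem invSq_le_four_mul (n : ℕ) : invSq n ≤ 4 * invSq (n + 1) := by
  rcases n with _ | n
  · simp [invSq]
  · rw [invSq_succ, invSq_succ, mul_one_div, div_le_div_iff₀ (by positivity) (by positivity)]
    push_cast
    nlinarith [Nat.cast_nonneg (α := ℝ) n]

theorem invSq_succ_le (n : ℕ) : invSq (n + 2) ≤ invSq (n + 1) := by
  rw [invSq_succ, invSq_succ]
  push_cast
  apply one_div_le_one_div_of_le (by positivity)
  nlinarith [Nat.cast_nonneg (α := ℝ) n]

theorem sum_invSq_le (n : ℕ) : ∑ k ∈ Finset.range n, invSq (k + 1) ≤ 2 := by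
  have : ∀ n : ℕ, ∑ k ∈ Finset.range (n + 1), invSq (k + 1) ≤ 2 - 1 / ((n : ℝ) + 1) := by
    intro n
    induction n with
    | zero => simp [invSq]; norm_num
    | succ n ih =>
      rw [Finset.sum_range_succ, invSq_succ]
      push_cast
      have h : 1 / ((n : ℝ) + 1 + 1) ^ 2 ≤ 1 / ((n : ℝ) + 1) - 1 / ((n : ℝ) + 1 + 1) := by
        rw [div_sub_div _ _ (by positivity) (by positivity),
          div_le_div_iff₀ (by positivity) (by positivity)]
        nlinarith [Nat.cast_nonneg (α := ℝ) n]
      linarith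
  rcases n with _ | n
  · simp
  · refine (this n).trans ?_
    have : (0 : ℝ) ≤ 1 / ((n : ℝ) + 1) := by positivity
    linarith

theorem sum_invSq_mul_le (n : ℕ) :
    ∑ k ∈ Finset.range (n + 1), invSq (k + 1) * invSq (n - k) ≤ 9 * invSq (n + 1) := by
  rw [Finset.sum_range_succ, Nat.sub_self]
  have h0 : invSq 0 = 1 := by simp [invSq]
  rw [h0, mul_one]
  have h1 : ∀ k ∈ Finset.range n, invSq (k + 1) * invSq (n - k) ≤
      2 * invSq (n + 1) * (invSq (k + 1) + invSq (n - 1 - k + 1)) := by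
    intro k hk
    have hkn := Finset.mem_range.1 hk
    obtain ⟨m, rfl⟩ : ∃ m, n = k + 1 + m := ⟨n - (k + 1), by omega⟩
    have e1 : k + 1 + m - k = m + 1 := by omega
    have e2 : k + 1 + m - 1 - k + 1 = m + 1 := by omega
    rw [e1, e2, invSq_succ, invSq_succ, invSq_succ]
    push_cast
    set a : ℝ := (k : ℝ) + 1 with ha
    set b : ℝ := (m : ℝ) + 1 with hb
    have ha0 : 0 < a := by positivity
    have hb0 : 0 < b := by positivity
    have : (k : ℝ) + 1 + m + 1 = a + b := by rw [ha, hb]; ring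
    rw [this]
    have hab : (a + b) ^ 2 ≤ 2 * (b ^ 2 + a ^ 2) := by nlinarith [sq_nonneg (a - b)]
    calc 1 / a ^ 2 * (1 / b ^ 2) = (a + b) ^ 2 / (a + b) ^ 2 * (1 / (a ^ 2 * b ^ 2)) := by
          field_simp
      _ ≤ 2 * (b ^ 2 + a ^ 2) / (a + b) ^ 2 * (1 / (a ^ 2 * b ^ 2)) := by gcongr
      _ = _ := by field_simp
  have h2 := Finset.sum_le_sum h1
  rw [← Finset.mul_sum, Finset.sum_add_distrib,
    Finset.sum_range_reflect (fun k => invSq (k + 1)) n] at h2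
  have h3 := sum_invSq_le n
  have h4 := invSq_pos (n + 1)
  nlinarith

theorem path_recursion_le (q ε D : ℝ) (hq : 0 < q) (h : 4 * ε / q + 9 * D * q ≤ 1)
    (hε : 0 ≤ ε) (hD : 0 ≤ D) (n : ℕ) :
    ε * (q ^ n * invSq n) + ∑ k ∈ Finset.range (n + 1),
      D * ((q ^ (k + 2) * invSq (k + 2)) * (q ^ (n - k) * invSq (n - k))) ≤
      q ^ (n + 1) * invSq (n + 1) := by
  have h1 : ε * (q ^ n * invSq n) ≤ 4 * ε / q * (q ^ (n + 1) * invSq (n + 1)) := by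
    have : 4 * ε / q * (q ^ (n + 1) * invSq (n + 1)) = ε * (q ^ n * (4 * invSq (n + 1))) := by
      field_simp
      ring
    rw [this]
    have := invSq_le_four_mul n
    gcongr
  have h2 : ∀ k ∈ Finset.range (n + 1),
      D * ((q ^ (k + 2) * invSq (k + 2)) * (q ^ (n - k) * invSq (n - k))) ≤
      D * q * q ^ (n + 1) * (invSq (k + 1) * invSq (n - k)) := by
    intro k hk
    have hkn := Finset.mem_range.1 hk
    have e : q ^ (k + 2) * q ^ (n - k) = q * q ^ (n + 1) := by
      rw [← pow_add, ← pow_succ']; congr 1; omega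
    calc D * ((q ^ (k + 2) * invSq (k + 2)) * (q ^ (n - k) * invSq (n - k)))
        = D * (q ^ (k + 2) * q ^ (n - k)) * (invSq (k + 2) * invSq (n - k)) := by ring
      _ ≤ D * (q ^ (k + 2) * q ^ (n - k)) * (invSq (k + 1) * invSq (n - k)) := by
          have := invSq_succ_le k
          have := (invSq_pos (n - k)).le
          gcongr
      _ = _ := by rw [e]; ring
  have h3 : ∑ k ∈ Finset.range (n + 1),
      D * ((q ^ (k + 2) * invSq (k + 2)) * (q ^ (n - k) * invSq (n - k))) ≤
      D * q * q ^ (n + 1) * ∑ k ∈ Finset.range (n + 1), invSq (k + 1) * invSq (n - k) := by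
    rw [Finset.mul_sum]
    exact Finset.sum_le_sum h2
  have h4 : D * q * q ^ (n + 1) * ∑ k ∈ Finset.range (n + 1), invSq (k + 1) * invSq (n - k) ≤
      D * q * q ^ (n + 1) * (9 * invSq (n + 1)) :=
    mul_le_mul_of_nonneg_left (sum_invSq_mul_le n) (by positivity)
  have h5 : 0 < q ^ (n + 1) * invSq (n + 1) := mul_pos (by positivity) (invSq_pos _)
  nlinarith [mul_le_mul_of_nonneg_right h h5.le]

/-! ### Clusters of zeros in an acyclic graph -/

/-- `x` has two neighbours in `U`. -/
def HasPair {V : Type*} (G : SimpleGraph V) (U : Set V) (x : V) : Prop :=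
  ∃ p q, p ≠ q ∧ G.Adj x p ∧ G.Adj x q ∧ p ∈ U ∧ q ∈ U

/-- The vertices `a` and `b` of `U` are joined by a chain of vertices of `U` such that successive
ones have a common neighbour. -/
def Linked {V : Type*} (G : SimpleGraph V) (U : Set V) : V → V → Prop :=
  Relation.ReflTransGen fun a b => a ∈ U ∧ b ∈ U ∧ ∃ y, G.Adj a y ∧ G.Adj b y

theorem Linked.symm {V : Type*} {G : SimpleGraph V} {U : Set V} {a b : V} (h : Linked G U a b) :
    Linked G U b a := by
  induction h with
  | refl => exact .refl
  | tail _ hbc ih =>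
    obtain ⟨hb, hc, y, hby, hcy⟩ := hbc
    exact ih.head ⟨hc, hb, y, hcy, hby⟩

/-- The cluster of zeros that forces `x` to be zero at the next time; empty if there is none. -/
def explaining {V : Type*} (G : SimpleGraph V) (U : Set V) (x : V) : Set V :=
  {z | HasPair G U x ∧ ∃ p ∈ U, G.Adj x p ∧ Linked G U p z}

theorem linked_of_mem_explaining {V : Type*} {G : SimpleGraph V} {U : Set V} {x u z : V}
    (hz : z ∈ explaining G U x) (hu : u ∈ U) (hxu : G.Adj x u) : Linked G U u z := by
  obtain ⟨_, p, hp, hxp, h⟩ := hz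
  exact Relation.ReflTransGen.head ⟨hu, hp, x, hxu.symm, hxp.symm⟩ h

theorem linked_succ {V : Type*} {G : SimpleGraph V} {U U' : Set V}
    (hU : ∀ y, HasPair G U y → y ∈ U') {x p p' : V} (hx : x ∈ U') (hxp : G.Adj x p)
    (h : Linked G U p p') : ∀ x' ∈ U', G.Adj x' p' → Linked G U' x x' := by
  induction h with
  | refl => exact fun x' hx' h' => .single ⟨hx, hx', p, hxp, h'⟩
  | @tail b c _ hbc ih =>
    intro x' hx' hxc
    obtain ⟨hb, hc, y, hby, hcy⟩ := hbc
    by_cases hbc : b = c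
    · subst hbc; exact ih x' hx' hxc
    · have hy : y ∈ U' := hU y ⟨b, c, hbc, hby.symm, hcy.symm, hb, hc⟩
      exact (ih y hy hby.symm).tail ⟨hy, hx', c, hcy.symm, hxc⟩

theorem isPath_cons_of_ne {V : Type*} {G : SimpleGraph V} (hG : G.IsAcyclic) {a b c : V}
    (h : G.Adj a b) (p : G.Walk b c) (hp : p.IsPath) (hne : 1 ≤ p.length → a ≠ p.getVert 1) :
    (SimpleGraph.Walk.cons h p).IsPath := by
  rw [hG.isPath_iff_isChain] at hp ⊢
  cases p with
  | nil => simp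
  | @cons _ w _ h' p =>
    rw [SimpleGraph.Walk.edges_cons, SimpleGraph.Walk.edges_cons, List.isChain_cons_cons]
    refine ⟨fun heq => ?_, by rwa [SimpleGraph.Walk.edges_cons] at hp⟩
    rcases Sym2.eq_iff.1 heq with ⟨h1, _⟩ | ⟨h1, _⟩
    · exact h.ne h1
    · exact hne (by simp) (by simpa using h1)

theorem isPath_cons_cons {V : Type*} {G : SimpleGraph V} (hG : G.IsAcyclic) {a b c d : V}
    (h : G.Adj a b) (h' : G.Adj b c) (p : G.Walk c d) (hp : (SimpleGraph.Walk.cons h' p).IsPath)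
    (hac : a ≠ c) : (SimpleGraph.Walk.cons h (.cons h' p)).IsPath :=
  isPath_cons_of_ne hG h _ hp fun _ => by simpa using hac

theorem isPath_cons_nil {V : Type*} {G : SimpleGraph V} {a b : V} (h : G.Adj a b) :
    (SimpleGraph.Walk.cons h .nil).IsPath := by
  simp [SimpleGraph.Walk.cons_isPath_iff, h.ne]

theorem exists_path_of_linked {V : Type*} {G : SimpleGraph V} (hG : G.IsAcyclic) {U : Set V}
    {a b : V} (hb : b ∈ U) (h : Linked G U a b) :
    ∃ p : G.Walk a b, p.IsPath ∧ Even p.length ∧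
      ∀ i, 2 * i ≤ p.length → p.getVert (2 * i) ∈ U ∧ Linked G U (p.getVert (2 * i)) b := by
  induction h using Relation.ReflTransGen.head_induction_on with
  | refl => exact ⟨.nil, by simp, by simp, fun i hi => by simpa using ⟨hb, .refl⟩⟩
  | @head a c hac hcb ih =>
    have hab : Linked G U a b := hcb.head hac
    obtain ⟨ha, hc, y, hay, hcy⟩ := hac
    obtain ⟨p, hp, hev, hpU⟩ := ih
    by_cases hac : a = c
    · subst hac; exact ⟨p, hp, hev, hpU⟩
    cases p with
    | nil =>
      refine ⟨.cons hay (.cons hcy.symm .nil), isPath_cons_cons hG _ _ _ (isPath_cons_nil _) hac,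
        by simp, ?_⟩
      rintro (_ | _ | i) hi
      · exact ⟨ha, hab⟩
      · exact ⟨hc, .refl⟩
      · simp at hi
    | @cons _ w _ hcw p₂ =>
      by_cases hwy : w = y
      · subst hwy
        cases p₂ with
        | nil => simp at hev
        | @cons _ w₂ _ hw₂ p₃ =>
          by_cases haw : w₂ = a
          · subst haw
            refine ⟨p₃, (hp.of_cons).of_cons, ?_, ?_⟩
            · simpa [Nat.even_add_one] using hev
            · intro i hi
              have := hpU (i + 1) (by simp only [SimpleGraph.Walk.length_cons]; omega)
              simpa [mul_add] using this
          · refine ⟨.cons hay (.cons hw₂ p₃), isPath_cons_cons hG _ _ _ hp.of_cons (Ne.symm haw),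
              by simpa using hev, ?_⟩
            rintro (_ | i) hi
            · exact ⟨ha, hab⟩
            · have := hpU (i + 1) (by simpa using hi)
              simpa [mul_add] using this
      · refine ⟨.cons hay (.cons hcy.symm (.cons hcw p₂)), isPath_cons_cons hG _ _ _
          (isPath_cons_cons hG _ _ _ hp (Ne.symm hwy)) hac, ?_, ?_⟩
        · simpa [Nat.even_add_one] using hev
        · rintro (_ | i) hi
          · exact ⟨ha, hab⟩
          · have := hpU i (by simp only [SimpleGraph.Walk.length_cons] at hi ⊢; omega)
            simpa [mul_add] using this

/-- `v 0, …, v m` is a walk without backtracking. -/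
def NonBacktracking {V : Type*} (G : SimpleGraph V) (m : ℕ) (v : ℕ → V) : Prop :=
  (∀ i < m, G.Adj (v i) (v (i + 1))) ∧ ∀ i, i + 2 ≤ m → v i ≠ v (i + 2)

theorem NonBacktracking.exists_path {V : Type*} {G : SimpleGraph V} (hG : G.IsAcyclic) (m : ℕ) :
    ∀ v : ℕ → V, NonBacktracking G m v →
      ∃ p : G.Walk (v 0) (v m), p.IsPath ∧ p.length = m ∧ ∀ i ≤ m, p.getVert i = v i := by
  induction m with
  | zero => exact fun v _ => ⟨.nil, by simp, by simp, fun i hi => by simp [Nat.le_zero.1 hi]⟩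
  | succ m ih =>
    intro v hv
    obtain ⟨p, hp, hpm, hpv⟩ := ih (fun i => v (i + 1))
      ⟨fun i hi => hv.1 (i + 1) (by omega), fun i hi => hv.2 (i + 1) (by omega)⟩
    refine ⟨.cons (hv.1 0 (by omega)) p, ?_, by simp [hpm], ?_⟩
    · refine isPath_cons_of_ne hG _ p hp fun h1 => ?_
      rw [hpv 1 (by omega)]
      exact hv.2 0 (by omega)
    · rintro (_ | i) hi
      · simp
      · simpa using hpv i (by omega)

theorem NonBacktracking.injOn {V : Type*} {G : SimpleGraph V} (hG : G.IsAcyclic) {m : ℕ}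
    {v : ℕ → V} (hv : NonBacktracking G m v) {i k : ℕ} (hi : i ≤ m) (hk : k ≤ m) (h : v i = v k) :
    i = k := by
  obtain ⟨p, hp, hpm, hpv⟩ := NonBacktracking.exists_path hG m v hv
  exact hp.getVert_injOn (by simpa [hpm] using hi) (by simpa [hpm] using hk)
    (by rw [hpv i hi, hpv k hk, h])

/-- In an acyclic graph, every second vertex of a non-backtracking walk between two linked
vertices belongs to their cluster. -/
theorem NonBacktracking.mem_of_linked {V : Type*} {G : SimpleGraph V} (hG : G.IsAcyclic)
    {U : Set V} {m : ℕ} {v : ℕ → V} (hv : NonBacktracking G m v) (hm : v m ∈ U)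
    (h : Linked G U (v 0) (v m)) (i : ℕ) (hi : 2 * i ≤ m) :
    v (2 * i) ∈ U ∧ Linked G U (v (2 * i)) (v m) := by
  obtain ⟨p, hp, hpm, hpv⟩ := NonBacktracking.exists_path hG m v hv
  obtain ⟨p', hp', _, hpU⟩ := exists_path_of_linked hG hm h
  have heq : p = p' := congrArg Subtype.val ((hG.subsingleton_path _ _).elim ⟨p, hp⟩ ⟨p', hp'⟩)
  subst heq
  rw [← hpv _ hi]
  exact hpU i (by omega)

/-! ### The consensus process on a regular tree -/

/-- The zeros of the process in which a vertex becomes zero by noise or by two zero neighbours. -/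
def pairZeros {V : Type*} (G : SimpleGraph V) (ε : ℝ) (L : V × ℕ → I) : ℕ → Set V
  | 0 => ∅
  | t + 1 => {x | (L (x, t + 1) : ℝ) < ε ∨ HasPair G (pairZeros G ε L t) x}

theorem HasPair.mono {V : Type*} {G : SimpleGraph V} {U W : Set V} (h : U ⊆ W) {x : V}
    (hx : HasPair G U x) : HasPair G W x := by
  obtain ⟨p, q, hpq, hp, hq, hpU, hqU⟩ := hx
  exact ⟨p, q, hpq, hp, hq, h hpU, h hqU⟩

theorem hasPair_of_outDeg_add_two_le {V : Type*} {G : SimpleGraph V} [G.LocallyFinite] {U : Set V}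
    {x : V} (h : outDeg G U x + 2 ≤ G.degree x) : HasPair G U x := by
  classical
  rw [outDeg_eq_card] at h
  have h1 := Finset.card_filter_add_card_filter_not (s := G.neighborFinset x) (· ∈ U)
  rw [SimpleGraph.card_neighborFinset_eq_degree] at h1
  obtain ⟨p, hp, q, hq, hpq⟩ := Finset.one_lt_card.1
    (show 1 < ((G.neighborFinset x).filter (· ∈ U)).card by omega)
  simp only [Finset.mem_filter, SimpleGraph.mem_neighborFinset] at hp hq
  exact ⟨p, q, hpq, hp.1, hq.1, hp.2, hq.2⟩

theorem zeros_cpStep_subset_pairZeros {V : Type*} (G : SimpleGraph V) [G.LocallyFinite] {j d : ℕ}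
    (hreg : G.IsRegularOfDegree d) (hj : j < d) (ε : ℝ) (L : V × ℕ → I) (t : ℕ) :
    zeros (cpStep G j ε) L t ⊆ pairZeros G ε L t := by
  induction t with
  | zero => exact fun x hx => absurd hx (not_mem_zeros_zero _ L x)
  | succ t ih =>
    intro x hx
    refine (mem_zeros_cpStep_succ G j ε L t x hx).imp id fun h => ?_
    refine (hasPair_of_outDeg_add_two_le ?_).mono ih
    rw [hreg x]
    omega

/-- The first `n` vertices of even index on a walk `v`, where `K = (n, v)`. -/
def evens {V : Type*} (K : ℕ × (ℕ → V)) : Set V := {x | ∃ i < K.1, x = K.2 (2 * i)}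

/-- The walk `K.2` does not backtrack up to its last vertex in `evens K`. -/
def IsProperWalk {V : Type*} (G : SimpleGraph V) (K : ℕ × (ℕ → V)) : Prop :=
  NonBacktracking G (2 * (K.1 - 1)) K.2

/-- Remove the first `m` vertices of even index. -/
def dropWalk {V : Type*} (m : ℕ) (K : ℕ × (ℕ → V)) : ℕ × (ℕ → V) :=
  (K.1 - m, fun i => K.2 (i + 2 * m))

/-- The walk from `u` to `u'` through `v 0, …, v (2 * k)`. -/
def detour {V : Type*} (v : ℕ → V) (k : ℕ) (u u' : V) : ℕ × (ℕ → V) :=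
  (k + 2, fun i => if i = 0 then u else if i ≤ 2 * k + 1 then v (i - 1) else u')

theorem evens_dropWalk_subset {V : Type*} (m : ℕ) (K : ℕ × (ℕ → V)) :
    evens (dropWalk m K) ⊆ evens K := by
  rintro x ⟨i, hi, rfl⟩
  simp only [dropWalk] at hi ⊢
  exact ⟨i + m, by omega, by rw [mul_add]⟩

theorem IsProperWalk.dropWalk {V : Type*} {G : SimpleGraph V} {K : ℕ × (ℕ → V)}
    (h : IsProperWalk G K) (m : ℕ) : IsProperWalk G (dropWalk m K) := by
  refine ⟨fun i hi => ?_, fun i hi => ?_⟩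
  · simp only [NoisyGraph.dropWalk] at hi ⊢
    have := h.1 (i + 2 * m) (by omega)
    rwa [add_right_comm] at this
  · simp only [NoisyGraph.dropWalk] at hi ⊢
    rcases Nat.eq_zero_or_pos (K.1 - m - 1) with h0 | h0
    · omega
    have := h.2 (i + 2 * m) (by omega)
    rwa [add_right_comm] at this

/-- `K₁` and `K₂` have no vertices of even index in the same cluster of `U`. -/
def Unlinked {V : Type*} (G : SimpleGraph V) (U : Set V) (K₁ K₂ : ℕ × (ℕ → V)) : Prop :=
  ∀ x ∈ evens K₁, ∀ y ∈ evens K₂, ¬ Linked G U x y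

/-- The points of `N` are noisy and the walks of `P` run through distinct clusters of zeros. -/
def zeroWalks {V : Type*} (G : SimpleGraph V) (ε : ℝ) (t : ℕ) (N : Finset (V × ℕ))
    (P : List (ℕ × (ℕ → V))) : Set (V × ℕ → I) :=
  {L | L ∈ noisy ε N ∧ (∀ K ∈ P, evens K ⊆ pairZeros G ε L t) ∧
    P.Pairwise (Unlinked G (pairZeros G ε L t))}

/-- The event between times `t + 1` and `t`, where the walks of `R` are still to be explained. -/
def partialWalks {V : Type*} (G : SimpleGraph V) (ε : ℝ) (t : ℕ) (N : Finset (V × ℕ))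
    (R P : List (ℕ × (ℕ → V))) : Set (V × ℕ → I) :=
  {L | L ∈ zeroWalks G ε t N P ∧
    (∀ K ∈ R, ∀ x ∈ evens K, x ∈ pairZeros G ε L (t + 1) ∧ (x, t + 1) ∉ N) ∧
    (∀ K ∈ R, ∀ x ∈ evens K, ∀ K' ∈ P, ∀ y ∈ evens K',
      y ∉ explaining G (pairZeros G ε L t) x) ∧
    R.Pairwise fun K K' => ∀ x ∈ evens K, ∀ y ∈ evens K', x ≠ y ∧
      Disjoint (explaining G (pairZeros G ε L t) x) (explaining G (pairZeros G ε L t) y)}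

theorem zeroWalks_succ_subset {V : Type*} (G : SimpleGraph V) (ε : ℝ) (t : ℕ)
    (N : Finset (V × ℕ)) (hN : ∀ p ∈ N, t + 1 < p.2) (R : List (ℕ × (ℕ → V))) :
    zeroWalks G ε (t + 1) N R ⊆ partialWalks G ε t N R [] := by
  rintro L ⟨hL, hR, hp⟩
  refine ⟨⟨hL, by simp, by simp⟩, fun K hK x hx => ⟨hR K hK hx, fun h => (hN _ h).ne rfl⟩,
    by simp, ?_⟩
  refine List.Pairwise.imp_of_mem ?_ hp
  intro K K' hK hK' h x hx y hy
  refine ⟨fun hxy => h x hx y hy (hxy ▸ .refl), Set.disjoint_left.2 fun z hz hz' => ?_⟩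
  obtain ⟨_, p, hpU, hxp, hpz⟩ := hz
  obtain ⟨_, p', hpU', hyp, hpz'⟩ := hz'
  exact h x hx y hy (linked_succ (fun w hw => Or.inr hw) (hR K hK hx) hxp
    (hpz.trans hpz'.symm) y (hR K' hK' hy) hyp)

theorem mem_evens_zero {V : Type*} (n : ℕ) (v : ℕ → V) : v 0 ∈ evens (n + 1, v) :=
  ⟨0, Nat.succ_pos n, rfl⟩

/-- If `v 0` is noisy, it can be moved from the walk to the set of noisy points. -/
theorem partialWalks_noise {V : Type*} {G : SimpleGraph V} (hG : G.IsAcyclic) {ε : ℝ} {t : ℕ}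
    {N : Finset (V × ℕ)} [DecidableEq V] {R P : List (ℕ × (ℕ → V))} {n : ℕ} {v : ℕ → V}
    (hv : IsProperWalk G (n + 1, v)) {L : V × ℕ → I}
    (hL : L ∈ partialWalks G ε t N ((n + 1, v) :: R) P) (hn : (L (v 0, t + 1) : ℝ) < ε) :
    L ∈ partialWalks G ε t (insert (v 0, t + 1) N) (dropWalk 1 (n + 1, v) :: R) P := by
  obtain ⟨⟨h1, h2, h3⟩, h4, h5, h6⟩ := hL
  rw [List.pairwise_cons] at h6
  rw [List.forall_mem_cons] at h4 h5
  have hsub := evens_dropWalk_subset 1 (n + 1, v)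
  refine ⟨⟨?_, h2, h3⟩, ?_, ?_, ?_⟩
  · intro p hp
    rcases Finset.mem_insert.1 hp with rfl | hp
    · exact hn
    · exact h1 p hp
  · rw [List.forall_mem_cons]
    refine ⟨fun x hx => ⟨(h4.1 x (hsub hx)).1, fun h => ?_⟩,
      fun K hK x hx => ⟨(h4.2 K hK x hx).1, fun h => ?_⟩⟩
    · rcases Finset.mem_insert.1 h with h | h
      · obtain ⟨i, hi, rfl⟩ := hx
        simp only [dropWalk, Prod.mk.injEq, and_true] at hi h
        have := NonBacktracking.injOn hG hv (i := 2 * i + 2 * 1) (k := 0)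
          (by simp only; omega) (by omega) h
        omega
      · exact (h4.1 x (hsub hx)).2 h
    · rcases Finset.mem_insert.1 h with h | h
      · exact (h6.1 K hK _ (mem_evens_zero n v) x hx).1 (congrArg Prod.fst h).symm
      · exact (h4.2 K hK x hx).2 h
  · rw [List.forall_mem_cons]
    exact ⟨fun x hx => h5.1 x (hsub hx), h5.2⟩
  · rw [List.pairwise_cons]
    exact ⟨fun K hK x hx => h6.1 K hK x (hsub hx), h6.2⟩

theorem isProperWalk_detour {V : Type*} {G : SimpleGraph V} {n k : ℕ} {v : ℕ → V}
    (hv : IsProperWalk G (n + 1, v)) (hk : k ≤ n) {u u' : V} (hu : G.Adj (v 0) u)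
    (hu' : G.Adj (v (2 * k)) u') (h0 : k = 0 → u ≠ u') (h1 : k ≠ 0 → u ≠ v 1)
    (h2 : k ≠ 0 → u' ≠ v (2 * k - 1)) : IsProperWalk G (detour v k u u') := by
  simp only [IsProperWalk, Nat.add_sub_cancel] at hv
  refine ⟨fun i hi => ?_, fun i hi => ?_⟩
  · simp only [detour] at hi ⊢
    rcases i with _ | i
    · simpa using hu.symm
    · by_cases hik : i = 2 * k
      · subst hik
        simpa using hu'
      · have h3 : i + 1 ≤ 2 * k + 1 := by omega
        have h4 : i + 1 + 1 ≤ 2 * k + 1 := by omega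
        simp only [Nat.succ_ne_zero, if_false, h3, h4, if_true, Nat.add_sub_cancel]
        exact hv.1 i (by omega)
  · simp only [detour] at hi ⊢
    rcases i with _ | i
    · by_cases hk0 : k = 0
      · subst hk0
        simpa using h0 rfl
      · have h3 : 2 ≤ 2 * k + 1 := by omega
        simpa [h3] using h1 hk0
    · have h3 : i + 1 ≤ 2 * k + 1 := by omega
      by_cases hik : i + 1 = 2 * k
      · have h4 : ¬ i + 1 + 2 ≤ 2 * k + 1 := by omega
        simp only [Nat.succ_ne_zero, if_false, h3, h4, if_true]
        have := h2 (by omega)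
        rw [show i + 1 - 1 = 2 * k - 1 by omega]
        exact this.symm
      · have h4 : i + 1 + 2 ≤ 2 * k + 1 := by omega
        simp only [Nat.succ_ne_zero, if_false, h3, h4, if_true]
        have := hv.2 i (by omega)
        simpa [show i + 1 + 2 - 1 = i + 2 by omega] using this

theorem HasPair.exists_ne {V : Type*} {G : SimpleGraph V} {U : Set V} {x : V} (h : HasPair G U x)
    (w : V) : ∃ u ∈ U, G.Adj x u ∧ u ≠ w := by
  obtain ⟨p, q, hpq, hp, hq, hpU, hqU⟩ := h
  by_cases hw : p = w
  · exact ⟨q, hqU, hq, fun h => hpq (hw.trans h.symm)⟩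
  · exact ⟨p, hpU, hp, hw⟩

/-- If `v 0` has two zero neighbours, the part of the walk explained by the same cluster can be
replaced by a detour through that cluster. -/
theorem partialWalks_detour {V : Type*} {G : SimpleGraph V} (hG : G.IsAcyclic) {ε : ℝ} {t : ℕ}
    {N : Finset (V × ℕ)} {R P : List (ℕ × (ℕ → V))} {n : ℕ} {v : ℕ → V}
    (hv : IsProperWalk G (n + 1, v)) {L : V × ℕ → I}
    (hL : L ∈ partialWalks G ε t N ((n + 1, v) :: R) P)
    (hp : HasPair G (pairZeros G ε L t) (v 0)) :
    ∃ k ≤ n, ∃ u u', G.Adj (v 0) u ∧ G.Adj (v (2 * k)) u' ∧ IsProperWalk G (detour v k u u') ∧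
      L ∈ partialWalks G ε t N (dropWalk (k + 1) (n + 1, v) :: R) (detour v k u u' :: P) := by
  classical
  set U := pairZeros G ε L t with hU
  obtain ⟨⟨h1, h2, h3⟩, h4, h5, h6⟩ := hL
  rw [← hU] at h2 h3 h5 h6
  rw [List.pairwise_cons] at h6
  rw [List.forall_mem_cons] at h4 h5
  let A : Finset ℕ := (Finset.range (n + 1)).filter fun k =>
    (explaining G U (v 0) ∩ explaining G U (v (2 * k))).Nonempty
  have hA0 : 0 ∈ A := by
    obtain ⟨p, q, hpq, hap, haq, hpU, hqU⟩ := id hp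
    have : p ∈ explaining G U (v 0) := ⟨hp, p, hpU, hap, .refl⟩
    exact Finset.mem_filter.2 ⟨by simp, p, this, this⟩
  set k := A.max' ⟨0, hA0⟩ with hk
  have hkA : k ∈ A := A.max'_mem _
  obtain ⟨hkn, z, hz, hz'⟩ := Finset.mem_filter.1 hkA
  have hkn : k ≤ n := by simpa [Nat.lt_succ_iff] using hkn
  have hmax : ∀ i, k < i → i ≤ n →
      Disjoint (explaining G U (v 0)) (explaining G U (v (2 * i))) := by
    intro i hi hin
    rw [Set.disjoint_iff_inter_eq_empty, ← Set.not_nonempty_iff_eq_empty]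
    intro h
    have := A.le_max' i (Finset.mem_filter.2 ⟨by simp; omega, h⟩)
    omega
  obtain ⟨u, u', huU, huU', hu, hu', c0, c1, c2⟩ : ∃ u u', u ∈ U ∧ u' ∈ U ∧ G.Adj (v 0) u ∧
      G.Adj (v (2 * k)) u' ∧ (k = 0 → u ≠ u') ∧ (k ≠ 0 → u ≠ v 1) ∧
      (k ≠ 0 → u' ≠ v (2 * k - 1)) := by
    by_cases hk0 : k = 0
    · obtain ⟨p, q, hpq, hap, haq, hpU, hqU⟩ := id hp
      exact ⟨p, q, hpU, hqU, hap, by simpa [hk0] using haq, fun _ => hpq, fun h => absurd hk0 h,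
        fun h => absurd hk0 h⟩
    · obtain ⟨u, huU, hu, hne⟩ := hp.exists_ne (v 1)
      obtain ⟨u', huU', hu', hne'⟩ := hz'.1.exists_ne (v (2 * k - 1))
      exact ⟨u, u', huU, huU', hu, hu', fun h => absurd h hk0, fun _ => hne, fun _ => hne'⟩
  have hw := isProperWalk_detour hv hkn hu hu' c0 c1 c2
  refine ⟨k, hkn, u, u', hu, hu', hw, ?_⟩
  have huu : Linked G U u u' :=
    (linked_of_mem_explaining hz huU hu).trans (linked_of_mem_explaining hz' huU' hu').symm
  have hlast : (detour v k u u').2 (2 * (k + 2 - 1)) = u' := by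
    simp only [detour]
    rw [if_neg (by omega), if_neg (by omega)]
  have hmem : ∀ x ∈ evens (detour v k u u'), x ∈ U ∧ Linked G U u x := by
    rintro x ⟨i, hi, rfl⟩
    have hw' : NonBacktracking G (2 * (k + 2 - 1)) (detour v k u u').2 := hw
    have := NonBacktracking.mem_of_linked hG (U := U) hw' (by rw [hlast]; exact huU')
      (by rw [hlast]; exact huu) i (by have : i < k + 2 := hi; omega)
    rw [hlast] at this
    exact ⟨this.1, huu.trans this.2.symm⟩
  have hexp : ∀ x ∈ evens (detour v k u u'), x ∈ explaining G U (v 0) :=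
    fun x hx => ⟨hp, u, huU, hu, (hmem x hx).2⟩
  have hv0 := mem_evens_zero n v
  have hsub := evens_dropWalk_subset (k + 1) (n + 1, v)
  refine ⟨⟨h1, ?_, ?_⟩, ?_, ?_, ?_⟩
  · rw [List.forall_mem_cons]
    exact ⟨fun x hx => (hmem x hx).1, h2⟩
  · rw [List.pairwise_cons]
    refine ⟨fun K hK x hx y hy hxy => ?_, h3⟩
    exact h5.1 _ hv0 K hK y hy ⟨hp, u, huU, hu, (hmem x hx).2.trans hxy⟩
  · rw [List.forall_mem_cons]
    exact ⟨fun x hx => h4.1 x (hsub hx), h4.2⟩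
  · rw [List.forall_mem_cons]
    refine ⟨fun x hx => ?_, fun K hK x hx => ?_⟩
    · rw [List.forall_mem_cons]
      refine ⟨fun y hy => ?_, fun K hK => h5.1 x (hsub hx) K hK⟩
      obtain ⟨i, hi, rfl⟩ := hx
      simp only [dropWalk] at hi ⊢
      rw [← mul_add]
      exact Set.disjoint_left.1 (hmax (i + (k + 1)) (by omega) (by omega)) (hexp y hy)
    · rw [List.forall_mem_cons]
      refine ⟨fun y hy => ?_, h5.2 K hK x hx⟩
      exact Set.disjoint_left.1 (h6.1 K hK _ hv0 x hx).2 (hexp y hy)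
  · rw [List.pairwise_cons]
    exact ⟨fun K hK x hx => h6.1 K hK x (hsub hx), h6.2⟩

/-- The bound for the probability that a walk runs through zeros. -/
noncomputable def walkWeight {V : Type*} (q : ℝ) (K : ℕ × (ℕ → V)) : ℝ := q ^ K.1 * invSq K.1

theorem walkWeight_pos {V : Type*} {q : ℝ} (hq : 0 < q) (K : ℕ × (ℕ → V)) :
    0 < walkWeight q K := mul_pos (by positivity) (invSq_pos _)

theorem prod_walkWeight_pos {V : Type*} {q : ℝ} (hq : 0 < q) (P : List (ℕ × (ℕ → V))) :
    0 < (P.map (walkWeight q)).prod := by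
  refine List.prod_pos fun a ha => ?_
  obtain ⟨K, _, rfl⟩ := List.mem_map.1 ha
  exact walkWeight_pos hq K

theorem noiseLaw_real_partialWalks_le {V : Type*} [DecidableEq V] (G : SimpleGraph V)
    [G.LocallyFinite] {d : ℕ}
    (hd : ∀ x, G.degree x ≤ d) (hG : G.IsAcyclic) {q ε : ℝ} (hq : 0 < q) (hε : 0 ≤ ε)
    (h : 4 * ε / q + 9 * (d : ℝ) ^ 2 * q ≤ 1) (t : ℕ)
    (ih : ∀ (N : Finset (V × ℕ)) (P : List (ℕ × (ℕ → V))), (∀ p ∈ N, t < p.2) →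
      (∀ K ∈ P, IsProperWalk G K) →
      (noiseLaw V).real (zeroWalks G ε t N P) ≤ ε ^ N.card * (P.map (walkWeight q)).prod)
    (R : List (ℕ × (ℕ → V))) : ∀ (N : Finset (V × ℕ)) (P : List (ℕ × (ℕ → V))),
      (∀ p ∈ N, t < p.2) → (∀ K ∈ P, IsProperWalk G K) → (∀ K ∈ R, IsProperWalk G K) →
      (noiseLaw V).real (partialWalks G ε t N R P) ≤
        ε ^ N.card * (P.map (walkWeight q)).prod * (R.map (walkWeight q)).prod := by
  induction R with
  | nil =>
    intro N P hN hP _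
    refine (measureReal_mono (fun L hL => hL.1) (measure_ne_top _ _)).trans ?_
    simpa using ih N P hN hP
  | cons K R ihR =>
    obtain ⟨n, v⟩ := K
    induction n using Nat.strong_induction_on generalizing v with
    | _ n ihn =>
    intro N P hN hP hR
    obtain ⟨hv, hR'⟩ := List.forall_mem_cons.1 hR
    rcases n with _ | n
    · refine (measureReal_mono (s₂ := partialWalks G ε t N R P) ?_ (measure_ne_top _ _)).trans ?_
      · rintro L ⟨h1, h2, h3, h4⟩
        exact ⟨h1, (List.forall_mem_cons.1 h2).2, (List.forall_mem_cons.1 h3).2,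
          (List.pairwise_cons.1 h4).2⟩
      · refine (ihR N P hN hP hR').trans ?_
        simp [walkWeight, invSq]
    · have hsub : partialWalks G ε t N ((n + 1, v) :: R) P ⊆
          {L | L ∈ partialWalks G ε t N ((n + 1, v) :: R) P ∧ (L (v 0, t + 1) : ℝ) < ε} ∪
          ⋃ k ∈ Finset.range (n + 1), ⋃ w ∈ G.neighborFinset (v 0) ×ˢ G.neighborFinset (v (2 * k)),
            {L | IsProperWalk G (detour v k w.1 w.2) ∧ L ∈ partialWalks G ε t N
              (dropWalk (k + 1) (n + 1, v) :: R) (detour v k w.1 w.2 :: P)} := by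
        intro L hL
        rcases ((List.forall_mem_cons.1 hL.2.1).1 _ (mem_evens_zero n v)).1 with hn | hp
        · exact Or.inl ⟨hL, hn⟩
        · obtain ⟨k, hk, u, u', hu, hu', hw, hm⟩ := partialWalks_detour hG hv hL hp
          refine Or.inr ?_
          simp only [Set.mem_iUnion]
          exact ⟨k, by simp; omega, (u, u'), by simp [hu, hu'], hw, hm⟩
      set B := ε ^ N.card * (P.map (walkWeight q)).prod * (R.map (walkWeight q)).prod with hB
      have hB0 : 0 ≤ B := by
        have := (prod_walkWeight_pos hq P).le
        have := (prod_walkWeight_pos hq R).le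
        positivity
      have hnoise : (noiseLaw V).real {L | L ∈ partialWalks G ε t N ((n + 1, v) :: R) P ∧
          (L (v 0, t + 1) : ℝ) < ε} ≤ B * (ε * (q ^ n * invSq n)) := by
        by_cases hmem : (v 0, t + 1) ∈ N
        · have : {L | L ∈ partialWalks G ε t N ((n + 1, v) :: R) P ∧
              (L (v 0, t + 1) : ℝ) < ε} = ∅ := by
            refine Set.eq_empty_of_forall_notMem fun L hL => ?_
            exact ((List.forall_mem_cons.1 hL.1.2.1).1 _ (mem_evens_zero n v)).2 hmem
          rw [this, measureReal_empty]
          have := (invSq_pos n).le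
          positivity
        · refine (measureReal_mono (fun L hL => partialWalks_noise hG hv hL.1 hL.2)
            (measure_ne_top _ _)).trans ?_
          refine (ihn n (Nat.lt_succ_self n) _ (insert (v 0, t + 1) N) P ?_ hP ?_).trans ?_
          · intro p hp
            rcases Finset.mem_insert.1 hp with rfl | hp
            · exact Nat.lt_succ_self t
            · exact hN p hp
          · exact List.forall_mem_cons.2 ⟨hv.dropWalk 1, hR'⟩
          · rw [Finset.card_insert_of_notMem hmem, List.map_cons, List.prod_cons, hB, walkWeight]
            apply le_of_eq
            ring
      have hdet : ∀ k ∈ Finset.range (n + 1),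
          ∀ w ∈ G.neighborFinset (v 0) ×ˢ G.neighborFinset (v (2 * k)),
          (noiseLaw V).real {L | IsProperWalk G (detour v k w.1 w.2) ∧ L ∈ partialWalks G ε t N
              (dropWalk (k + 1) (n + 1, v) :: R) (detour v k w.1 w.2 :: P)} ≤
            B * ((q ^ (k + 2) * invSq (k + 2)) * (q ^ (n - k) * invSq (n - k))) := by
        intro k hk w _
        by_cases hw : IsProperWalk G (detour v k w.1 w.2)
        · simp only [hw, true_and, Set.ofPred_mem_eq]
          have e : dropWalk (k + 1) (n + 1, v) = (n - k, fun i => v (i + 2 * (k + 1))) := by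
            simp [dropWalk]
          have hpr := hv.dropWalk (k + 1)
          rw [e] at hpr ⊢
          refine (ihn (n - k) (by omega) _ N (detour v k w.1 w.2 :: P) hN
            (List.forall_mem_cons.2 ⟨hw, hP⟩) (List.forall_mem_cons.2 ⟨hpr, hR'⟩)).trans ?_
          rw [List.map_cons, List.prod_cons, List.map_cons, List.prod_cons, hB, walkWeight,
            walkWeight, detour]
          apply le_of_eq
          ring
        · simp only [hw, false_and]
          have h1 := (invSq_pos (k + 2)).le
          have h2 := (invSq_pos (n - k)).le
          have : (noiseLaw V).real {L | False} = 0 := by simp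
          rw [this]
          positivity
      refine (measureReal_mono hsub (measure_ne_top _ _)).trans ?_
      refine (measureReal_union_le _ _).trans ?_
      have hcard : ∀ k ∈ Finset.range (n + 1), (noiseLaw V).real
          (⋃ w ∈ G.neighborFinset (v 0) ×ˢ G.neighborFinset (v (2 * k)),
            {L | IsProperWalk G (detour v k w.1 w.2) ∧ L ∈ partialWalks G ε t N
              (dropWalk (k + 1) (n + 1, v) :: R) (detour v k w.1 w.2 :: P)}) ≤
          B * ((d : ℝ) ^ 2 * ((q ^ (k + 2) * invSq (k + 2)) * (q ^ (n - k) * invSq (n - k)))) := by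
        intro k hk
        refine (measureReal_biUnion_finset_le _ _).trans ?_
        refine (Finset.sum_le_card_nsmul _ _ _ (hdet k hk)).trans ?_
        rw [Finset.card_product, nsmul_eq_mul, SimpleGraph.card_neighborFinset_eq_degree,
          SimpleGraph.card_neighborFinset_eq_degree]
        have h1 := (invSq_pos (k + 2)).le
        have h2 := (invSq_pos (n - k)).le
        have h3 : ((G.degree (v 0) * G.degree (v (2 * k)) : ℕ) : ℝ) ≤ (d : ℝ) ^ 2 := by
          have := Nat.mul_le_mul (hd (v 0)) (hd (v (2 * k)))
          rw [← sq] at this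
          exact_mod_cast this
        refine (mul_le_mul_of_nonneg_right h3
          (mul_nonneg hB0 (by positivity))).trans (le_of_eq (by ring))
      have hsum := (measureReal_biUnion_finset_le (μ := noiseLaw V) (Finset.range (n + 1))
        (fun k => ⋃ w ∈ G.neighborFinset (v 0) ×ˢ G.neighborFinset (v (2 * k)),
            {L | IsProperWalk G (detour v k w.1 w.2) ∧ L ∈ partialWalks G ε t N
              (dropWalk (k + 1) (n + 1, v) :: R) (detour v k w.1 w.2 :: P)})).trans
        (Finset.sum_le_sum hcard)
      rw [← Finset.mul_sum] at hsum
      refine (add_le_add hnoise hsum).trans ?_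
      rw [← mul_add, List.map_cons, List.prod_cons]
      have hrec := mul_le_mul_of_nonneg_left
        (path_recursion_le q ε ((d : ℝ) ^ 2) hq h hε (by positivity) n) hB0
      refine hrec.trans (le_of_eq ?_)
      rw [hB, walkWeight]
      ring

theorem noiseLaw_real_zeroWalks_le {V : Type*} (G : SimpleGraph V)
    [G.LocallyFinite] {d : ℕ}
    (hd : ∀ x, G.degree x ≤ d) (hG : G.IsAcyclic) {q ε : ℝ} (hq : 0 < q) (hε : 0 ≤ ε)
    (hε1 : ε ≤ 1) (h : 4 * ε / q + 9 * (d : ℝ) ^ 2 * q ≤ 1) (t : ℕ) :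
    ∀ (N : Finset (V × ℕ)) (P : List (ℕ × (ℕ → V))), (∀ p ∈ N, t < p.2) →
      (∀ K ∈ P, IsProperWalk G K) →
      (noiseLaw V).real (zeroWalks G ε t N P) ≤ ε ^ N.card * (P.map (walkWeight q)).prod := by
  classical
  induction t with
  | zero =>
    intro N P _ _
    by_cases hP : ∀ K ∈ P, K.1 = 0
    · refine (measureReal_mono (fun L hL => hL.1) (measure_ne_top _ _)).trans ?_
      rw [noiseLaw_real_noisy hε hε1, List.prod_eq_one, mul_one]
      intro a ha
      obtain ⟨K, hK, rfl⟩ := List.mem_map.1 ha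
      simp [walkWeight, invSq, hP K hK]
    · push Not at hP
      obtain ⟨K, hK, hK0⟩ := hP
      have : zeroWalks G ε 0 N P = ∅ := by
        refine Set.eq_empty_of_forall_notMem fun L hL => ?_
        exact hL.2.1 K hK ⟨0, Nat.pos_of_ne_zero hK0, rfl⟩
      rw [this, measureReal_empty]
      have := (prod_walkWeight_pos hq P).le
      positivity
  | succ t ih =>
    intro N P hN hP
    refine (measureReal_mono (zeroWalks_succ_subset G ε t N hN P) (measure_ne_top _ _)).trans ?_
    have := noiseLaw_real_partialWalks_le G hd hG hq hε h t ih P N []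
      (fun p hp => (Nat.lt_succ_self t).trans (hN p hp)) (by simp) hP
    simpa using this

theorem cpThreshold_pos_of_tree {V : Type*} (G : SimpleGraph V) [G.LocallyFinite] {d j : ℕ}
    (hG : G.IsTree) (hreg : G.IsRegularOfDegree d) (hj : j < d) : 0 < cpThreshold G j := by
  have hd0 : (1 : ℝ) ≤ d := by exact_mod_cast (Nat.zero_le j).trans_lt hj
  have hd2 : (1 : ℝ) ≤ (d : ℝ) ^ 2 := one_le_pow₀ hd0
  set q : ℝ := 1 / (18 * (d : ℝ) ^ 2) with hq
  have hq0 : 0 < q := by positivity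
  have hdq : (d : ℝ) ^ 2 * q = 1 / 18 := by rw [hq]; field_simp
  have hq1 : q ≤ 1 / 18 := by nlinarith
  obtain ⟨x⟩ := hG.connected.nonempty
  refine cpThreshold_pos G hG.connected j (q / 8) (by positivity) (by linarith) x fun t => ?_
  have h := noiseLaw_real_zeroWalks_le G (fun x => (hreg x).le) hG.isAcyclic hq0
    (ε := q / 8) (by positivity) (by linarith)
    (by rw [mul_assoc, hdq, show 4 * (q / 8) / q = 1 / 2 by field_simp; norm_num]; norm_num)
    t ∅ [(1, fun _ => x)] (by simp)
    (fun K hK => by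
      rw [List.mem_singleton.1 hK]
      exact ⟨fun i hi => absurd hi (by simp), fun i hi => absurd hi (by simp)⟩)
  refine (measureReal_mono ?_ (measure_ne_top _ _)).trans (h.trans ?_)
  · intro L hL
    refine ⟨by simp [noisy], fun K hK => ?_, by simp⟩
    rw [List.mem_singleton.1 hK]
    rintro y ⟨i, _, rfl⟩
    exact zeros_cpStep_subset_pairZeros G hreg hj _ L t hL
  · simp [walkWeight, invSq]
    linarith

end NoisyGraph

theorem corollary2p10 {V : Type*} [Infinite V] (G : SimpleGraph V) [G.LocallyFinite]
    (hconn : G.Connected) (hΔ : BddAbove (Set.range fun x => G.degree x))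
    (j : ℕ) (hj1 : 1 ≤ j) (hjδ : j ≤ NoisyGraph.infDegree G) :
    (NoisyGraph.OmegaGood G j → 0 < NoisyGraph.bpThreshold G j) ∧
    (NoisyGraph.ChiGood G j → 0 < NoisyGraph.cpThreshold G j) := by
  obtain ⟨D, hD⟩ := id hΔ
  have hD' : ∀ x, G.degree x ≤ D := fun x => hD ⟨x, rfl⟩
  refine ⟨?_, ?_⟩
  · rintro (h | h)
    · exact NoisyGraph.bpThreshold_pos_of_edgeExpansion G hconn hD' h
    · exact NoisyGraph.bpThreshold_pos_of_le_jbar G hconn hΔ h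
  · rintro (h | ⟨_, h⟩ | h | ⟨d, _, hT, hreg, h⟩)
    · refine NoisyGraph.cpThreshold_pos_of_edgeExpansion G hconn hD' ?_
      have := NoisyGraph.edgeExpansion_le_supDegree G hΔ
      linarith
    · exact NoisyGraph.cpThreshold_pos_of_edgeExpansion G hconn hD' h
    · exact NoisyGraph.cpThreshold_pos_of_vertexExpansion G hconn hD' h
    · exact NoisyGraph.cpThreshold_pos_of_tree G hT hreg h
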